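/- Let $G$ be a group generated by a finite set $S$, with the word metric $\mathrm{dist}(g,h)=|g^{-1}h|_S$. Suppose that all asymptotic cones $\mathrm{Con}^\omega(G,(d_i))$ of $G$ are simply connected, where $\omega$ runs over all non-principal ultrafilters on $\mathbb N$ and $(d_i)$ over all non-decreasing sequences of positive real numbers with $d_i\to\infty$. (The cone is the set of sequences $(g_i)$ in $G$ with $\lim^\omega \mathrm{dist}(g_i,1)/d_i<\infty$, with the distance $\lim^\omega \mathrm{dist}(g_i,h_i)/d_i$, modulo identifying sequences at distance $0$.) Then $G$ is finitely presented, and for every finite presentation $\langle X\mid R\rangle$ of $G$: 1. $G$ has a polynomial isoperimetric function: the Dehn function $f$ of $\langle X\mid R\rangle$ satisfies $f\prec p$ for some polynomial $p$, where $f(n)$ is the least number such that every word of length at most $n$ that equals $1$ in $G$ is the boundary label of a van Kampen diagram over $\langle X\mid R\rangle$ with at most $f(n)$ cells; 2. $G$ has a linear isodiametric function: $\mathrm{di}(n)\prec n$, where $\mathrm{di}(n)$ is the maximum, over all words $w$ of length at most $n$ that equal $1$ in $G$, of the minimal diameter (of the underlying graph) of a van Kampen diagram over $\langle X\mid R\rangle$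 with boundary label $w$. Here $f\prec g$ means that for some constant $C$ one has $f(n)\le C\,g(Cn)+Cn+C$ for all $n\in\mathbb N$. -/

import Mathlib

open Filter Topology

/-! ## The word metric of a finitely generated group -/

/-- The word length of `g` with respect to `S`: the least length of a product of elements of `S`
and their inverses that equals `g`. -/
noncomputable def wordLength {G : Type*} [Group G] (S : Finset G) (g : G) : ℕ :=
  sInf {n | ∃ l : List G, (∀ x ∈ l, x ∈ S ∨ x⁻¹ ∈ S) ∧ l.prod = g ∧ l.length = n}

section WordLength

variable {G : Type*} [Group G] {S : Finset G}

theorem exists_word_of_closure (hS : Subgroup.closure (S : Set G) = ⊤) (g : G) :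
    ∃ l : List G, (∀ x ∈ l, x ∈ S ∨ x⁻¹ ∈ S) ∧ l.prod = g ∧ l.length = wordLength S g := by
  have hne : {n | ∃ l : List G, (∀ x ∈ l, x ∈ S ∨ x⁻¹ ∈ S) ∧ l.prod = g ∧
      l.length = n}.Nonempty := by
    have hg : g ∈ (Subgroup.closure (S : Set G)).toSubmonoid := hS ▸ Subgroup.mem_top g
    rw [Subgroup.closure_toSubmonoid] at hg
    obtain ⟨l, hl, hp⟩ := Submonoid.exists_list_of_mem_closure hg
    exact ⟨l.length, l, by simpa using hl, hp, rfl⟩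
  exact Nat.sInf_mem hne

theorem wordLength_le (l : List G) (hl : ∀ x ∈ l, x ∈ S ∨ x⁻¹ ∈ S) :
    wordLength S l.prod ≤ l.length :=
  Nat.sInf_le ⟨l, hl, rfl, rfl⟩

theorem wordLength_one : wordLength S (1 : G) = 0 := by
  simpa using wordLength_le (S := S) ([] : List G) (by simp)

theorem wordLength_mul_le (hS : Subgroup.closure (S : Set G) = ⊤) (g h : G) :
    wordLength S (g * h) ≤ wordLength S g + wordLength S h := by
  obtain ⟨l, hl, rfl, hn⟩ := exists_word_of_closure hS g
  obtain ⟨m, hm, rfl, hk⟩ := exists_word_of_closure hS h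
  rw [← hn, ← hk, ← List.length_append, ← List.prod_append]
  refine wordLength_le _ fun x hx => ?_
  rcases List.mem_append.1 hx with hx | hx
  exacts [hl x hx, hm x hx]

theorem wordLength_inv_le (hS : Subgroup.closure (S : Set G) = ⊤) (g : G) :
    wordLength S g⁻¹ ≤ wordLength S g := by
  obtain ⟨l, hl, rfl, hn⟩ := exists_word_of_closure hS g
  rw [List.prod_inv_reverse]
  refine (wordLength_le _ fun x hx => ?_).trans (by simp [← hn])
  simp only [List.mem_reverse, List.mem_map] at hx
  obtain ⟨y, hy, rfl⟩ := hx
  simpa [or_comm] using hl y hy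

theorem eq_one_of_wordLength (hS : Subgroup.closure (S : Set G) = ⊤) {g : G}
    (hg : wordLength S g = 0) : g = 1 := by
  obtain ⟨l, -, rfl, hn⟩ := exists_word_of_closure hS g
  rw [hg, List.length_eq_zero_iff] at hn
  simp [hn]

end WordLength

/-- The group `G` regarded as a metric space: the vertex set of its Cayley graph with respect to
the finite generating set `S`, with the graph distance `dist g h = |g⁻¹ h|_S`. -/
def WordMetric {G : Type*} [Group G] (S : Finset G)
    (_hS : Subgroup.closure (S : Set G) = ⊤) : Type _ := G

noncomputable instance {G : Type*} [Group G] (S : Finset G)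
    (hS : Subgroup.closure (S : Set G) = ⊤) : MetricSpace (WordMetric S hS) where
  dist := fun (g h : G) => (wordLength S (g⁻¹ * h) : ℝ)
  dist_self := fun (g : G) => by
    simp [wordLength_one]
  dist_comm := fun (g h : G) => by
    have h₁ := wordLength_inv_le hS (g⁻¹ * h)
    have h₂ := wordLength_inv_le hS (h⁻¹ * g)
    simp only [mul_inv_rev, inv_inv] at h₁ h₂
    exact_mod_cast le_antisymm h₂ h₁
  dist_triangle := fun (g h k : G) => by
    have := wordLength_mul_le hS (g⁻¹ * h) (h⁻¹ * k)
    simp only [mul_assoc, mul_inv_cancel_left] at this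
    exact_mod_cast this
  eq_of_dist_eq_zero := fun {g h : G} hgh => by
    have h' : wordLength S (g⁻¹ * h) = 0 := by
      have : ((wordLength S (g⁻¹ * h) : ℕ) : ℝ) = 0 := hgh
      exact_mod_cast this
    exact (inv_mul_eq_one (G := G)).1 (eq_one_of_wordLength hS h')

/-- The identity element of `G`, as a point of the metric space `WordMetric S hS`. -/
def WordMetric.basepoint {G : Type*} [Group G] (S : Finset G)
    (hS : Subgroup.closure (S : Set G) = ⊤) : WordMetric S hS := (1 : G)

/-! ## Asymptotic cones -/

/-- Scaling constants: a non-decreasing sequence of positive reals tending to infinity. -/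
structure ScalingConstants where
  val : ℕ → ℝ
  pos : ∀ i, 0 < val i
  mono : Monotone val
  tendsto : Tendsto val atTop atTop

/-- The sequences `(x i)` in `X` at finite distance from the observation point `(o i)`, i.e. such
that `dist (x i) (o i) / d i` is bounded for `ω`-almost all `i`. -/
def BoundedSeq (X : Type*) [PseudoMetricSpace X] (ω : Ultrafilter ℕ) (d : ScalingConstants)
    (o : ℕ → X) : Type _ :=
  {x : ℕ → X // ∃ C : ℝ, ∀ᶠ i in (ω : Filter ℕ), dist (x i) (o i) / d.val i ≤ C}

section Cone

variable {X : Type*} [PseudoMetricSpace X] {ω : Ultrafilter ℕ} {d : ScalingConstants} {o : ℕ → X}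

/-- The `ω`-limit of the rescaled distances `dist (x i) (y i) / d i`. -/
noncomputable def BoundedSeq.limDist (x y : BoundedSeq X ω d o) : ℝ :=
  limUnder (ω : Filter ℕ) fun i => dist (x.1 i) (y.1 i) / d.val i

theorem BoundedSeq.tendsto_limDist (x y : BoundedSeq X ω d o) :
    Tendsto (fun i => dist (x.1 i) (y.1 i) / d.val i) (ω : Filter ℕ) (𝓝 (x.limDist y)) := by
  obtain ⟨C, hC⟩ := x.2
  obtain ⟨C', hC'⟩ := y.2
  have hmem : ∀ᶠ i in (ω : Filter ℕ),
      dist (x.1 i) (y.1 i) / d.val i ∈ Set.Icc (0 : ℝ) (C + C') := by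
    filter_upwards [hC, hC'] with i h h'
    refine ⟨div_nonneg dist_nonneg (d.pos i).le, ?_⟩
    refine le_trans ?_ (add_le_add h h')
    rw [← add_div]
    exact div_le_div_of_nonneg_right (dist_triangle_right _ _ _) (d.pos i).le
  obtain ⟨a, -, ha⟩ := isCompact_Icc.ultrafilter_le_nhds
    (ω.map fun i => dist (x.1 i) (y.1 i) / d.val i) (le_principal_iff.2 hmem)
  exact tendsto_nhds_limUnder ⟨a, ha⟩

noncomputable instance : PseudoMetricSpace (BoundedSeq X ω d o) where
  dist := BoundedSeq.limDist
  dist_self x := tendsto_nhds_unique (x.tendsto_limDist x) (by simp)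
  dist_comm x y := tendsto_nhds_unique (x.tendsto_limDist y)
    (by simpa only [dist_comm] using y.tendsto_limDist x)
  dist_triangle x y z := by
    refine le_of_tendsto_of_tendsto' (x.tendsto_limDist z)
      ((x.tendsto_limDist y).add (y.tendsto_limDist z)) fun i => ?_
    rw [← add_div]
    exact div_le_div_of_nonneg_right (dist_triangle _ _ _) (d.pos i).le

end Cone

/-- The asymptotic cone `Con^ω(X, (d i), (o i))`: the bounded sequences modulo the relation of being
at `ω`-limit distance `0`, with the metric induced by the `ω`-limit distance. -/
def AsymptoticCone (X : Type*) [PseudoMetricSpace X] (ω : Ultrafilter ℕ) (d : ScalingConstants)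
    (o : ℕ → X) : Type _ :=
  SeparationQuotient (BoundedSeq X ω d o)

noncomputable instance (X : Type*) [PseudoMetricSpace X] (ω : Ultrafilter ℕ) (d : ScalingConstants)
    (o : ℕ → X) : MetricSpace (AsymptoticCone X ω d o) :=
  inferInstanceAs (MetricSpace (SeparationQuotient (BoundedSeq X ω d o)))

/-- Every asymptotic cone of `G` (with the word metric of `S`, observed at the identity) with
respect to a non-principal ultrafilter and a sequence of scaling constants is simply connected. -/
def AllConesSimplyConnected {G : Type*} [Group G] (S : Finset G)
    (hS : Subgroup.closure (S : Set G) = ⊤) : Prop :=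
  ∀ ω : Ultrafilter ℕ, (ω : Filter ℕ) ≤ cofinite → ∀ d : ScalingConstants,
    SimplyConnectedSpace (AsymptoticCone (WordMetric S hS) ω d (fun _ => WordMetric.basepoint S hS))

/-! ## Van Kampen diagrams -/

/-- A van Kampen diagram with boundary label `w` over the presentation with set of relators `R`:
a finite connected graph drawn in the plane, given by its rotation system, with edges labelled by
generators, bounded faces ("cells") labelled by words from `R^{±1}`, and unbounded face labelled
by `w`. Every edge is a pair of opposite darts `a`, `rev a`; each dart has one face on its left,
whose contour continues with `next a`. Since `R^{±1}` is closed under inverses, it does not matter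
in which of the two senses the contours of the cells and of the diagram are read. -/
structure VanKampenDiagram {X : Type*} (R : Set (FreeGroup X)) (w : List (X × Bool)) where
  /-- vertices -/
  V : Type
  /-- darts (oriented edges) -/
  D : Type
  /-- faces, including the unbounded one -/
  F : Type
  [fintypeV : Fintype V]
  [fintypeD : Fintype D]
  [fintypeF : Fintype F]
  /-- the opposite dart -/
  rev : Equiv.Perm D
  rev_rev : ∀ a, rev (rev a) = a
  rev_ne : ∀ a, rev a ≠ a
  /-- the next dart on the contour of the face on the left -/
  next : Equiv.Perm D
  /-- the initial vertex of a dart -/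
  src : D → V
  /-- the face on the left of a dart -/
  face : D → F
  /-- `next ∘ rev` rotates the darts around their common initial vertex -/
  src_eq_iff : ∀ a b, src a = src b ↔ (next * rev).SameCycle a b
  face_eq_iff : ∀ a b, face a = face b ↔ next.SameCycle a b
  /-- the graph is connected -/
  connected : (SimpleGraph.fromRel fun u v => ∃ a, src a = u ∧ src (rev a) = v).Connected
  /-- planarity: Euler's formula `|V| - |E| + |F| = 2`, where `2 |E| = |D|` -/
  euler : 2 * (Fintype.card V + Fintype.card F) = Fintype.card D + 4
  /-- the label of a dart; `(x, true)` is the letter `x` and `(x, false)` the letter `x⁻¹` -/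
  label : D → X × Bool
  label_rev : ∀ a, label (rev a) = ((label a).1, !(label a).2)
  /-- the unbounded face -/
  outer : F
  /-- the contour of every cell, read from a suitable dart, is a word from `R^{±1}` -/
  cell_label : ∀ f, f ≠ outer → ∃ a, face a = f ∧ ∃ r : List (X × Bool),
    r = (List.range (Function.minimalPeriod next a)).map (fun i => label (next^[i] a)) ∧
    FreeGroup.IsReduced r ∧ (FreeGroup.mk r ∈ R ∨ (FreeGroup.mk r)⁻¹ ∈ R)
  /-- the contour of the unbounded face reads `w`; it is empty if the diagram is a point -/
  boundary_label : (IsEmpty D ∧ w = []) ∨ ∃ a, face a = outer ∧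
    w = (List.range (Function.minimalPeriod next a)).map (fun i => label (next^[i] a))

namespace VanKampenDiagram

variable {X : Type*} {R : Set (FreeGroup X)} {w : List (X × Bool)}

/-- The underlying graph of a diagram. -/
def graph (Δ : VanKampenDiagram R w) : SimpleGraph Δ.V :=
  SimpleGraph.fromRel fun u v => ∃ a, Δ.src a = u ∧ Δ.src (Δ.rev a) = v

/-- The number of cells, i.e. of bounded faces. -/
noncomputable def area (Δ : VanKampenDiagram R w) : ℕ := Nat.card {f : Δ.F // f ≠ Δ.outer}

/-- The diameter of the underlying graph. -/
noncomputable def diameter (Δ : VanKampenDiagram R w) : ℕ∞ := Δ.graph.ediam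

end VanKampenDiagram

/-! ## Isoperimetric and isodiametric functions -/

/-- The Dehn function of the presentation `⟨X ∣ R⟩`: the least `N` such that every word of length at
most `n` that is trivial in the group bounds a van Kampen diagram with at most `N` cells
(`⊤` if there is no such `N`). -/
noncomputable def dehnFunction {X : Type*} (R : Set (FreeGroup X)) (n : ℕ) : ℕ∞ :=
  ⨆ (w : List (X × Bool)) (_ : w.length ≤ n)
    (_ : FreeGroup.mk w ∈ Subgroup.normalClosure R),
    ⨅ Δ : VanKampenDiagram R w, (Δ.area : ℕ∞)

/-- The isodiametric function of `⟨X ∣ R⟩`: the maximum, over words of length at most `n` that are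
trivial in the group, of the minimal diameter of a van Kampen diagram with that boundary label. -/
noncomputable def diameterFunction {X : Type*} (R : Set (FreeGroup X)) (n : ℕ) : ℕ∞ :=
  ⨆ (w : List (X × Bool)) (_ : w.length ≤ n)
    (_ : FreeGroup.mk w ∈ Subgroup.normalClosure R),
    ⨅ Δ : VanKampenDiagram R w, Δ.diameter

/-- The relation `f ≺ g`: for some constant `C`, `f n ≤ C g(C n) + C n + C` for all `n`. -/
def Precedes (f : ℕ → ℕ∞) (g : ℕ → ℕ) : Prop :=
  ∃ C : ℕ, ∀ n : ℕ, f n ≤ ((C * g (C * n) + C * n + C : ℕ) : ℕ∞)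

/-- `g` is an isoperimetric function of the presentation `⟨X ∣ R⟩`. -/
def IsIsoperimetricFunction {X : Type*} (R : Set (FreeGroup X)) (g : ℕ → ℕ) : Prop :=
  Precedes (dehnFunction R) g

/-- `g` bounds the isodiametric function of the presentation `⟨X ∣ R⟩` in the sense of `≺`. -/
def IsIsodiametricFunction {X : Type*} (R : Set (FreeGroup X)) (g : ℕ → ℕ) : Prop :=
  Precedes (diameterFunction R) g

/-! The geometric half is Gromov's subdivision argument. Words trivial in `G` whose lengths tend to
infinity, rescaled by those lengths, converge to a Lipschitz loop in an asymptotic cone. This loop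
is contractible, and a fine grid on its contracting homotopy lifts back to `G` for almost every
index. Hence every sufficiently long trivial word of length `n` bounds a square grid with boundedly
many meshes whose sides are short compared with `n` (`exists_grid_of_simplyConnectedSpace`, then
`exists_grid` by contradiction). Read in the free group, the word is a product of a bounded number
`m` of conjugates of trivial words of length at most `n / 2`, with conjugators of length `O(n)`
(`exists_isConjProd_half`).

Halving is iterated until the words are short (`exists_isConjProd_of_half`). The number of factors
is multiplied by at most `m` about `log₂ n` times, hence is polynomial; the conjugator lengths add
up to a geometric series, hence are linear. Finitely many short words remain. Taking them as
relators proves finite presentability; expressing them through given relators treats an arbitrary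
finite presentation.

The combinatorial half is van Kampen's lemma with control of cells and diameter
(`exists_diagram_of_isConjProd`). Diagrams are built by growing pendant edges, closing cells and
folding edges. Planarity is carried through these moves as vanishing of first cohomology, the
`potential` fields, with distances encoded by Lipschitz potentials. At the end, rank-nullity
converts it into Euler's formula (`euler_of_potential`), and the distance function itself, used as a
potential, gives the diameter bound (`PermFilling.dist_le`). -/

/-! ## Planar fillings of words -/

/-- The list `l` of darts is a path from `p` to `q`, where the dart `x` leads from `s x` to
`t x`. -/
def IsDartPath {D α : Type*} (s t : D → α) : α → List D → α → Prop
  | p, [], q => p = q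
  | p, x :: l, q => s x = p ∧ IsDartPath s t (t x) l q

section DartPath

variable {D α : Type*} {s t : D → α}

theorem isDartPath_append {l m : List D} {p q : α} :
    IsDartPath s t p (l ++ m) q ↔ ∃ r, IsDartPath s t p l r ∧ IsDartPath s t r m q := by
  induction l generalizing p with
  | nil => simp [IsDartPath]
  | cons x l ih => simp [IsDartPath, ih, and_assoc]

theorem IsDartPath.congr {s' t' : D → α} {l : List D} {p q : α} (h : IsDartPath s t p l q)
    (hs : ∀ x ∈ l, s' x = s x) (ht : ∀ x ∈ l, t' x = t x) : IsDartPath s' t' p l q := by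
  induction l generalizing p with
  | nil => exact h
  | cons x l ih =>
    simp only [List.forall_mem_cons] at hs ht
    exact ⟨hs.1.trans h.1, ht.1 ▸ ih h.2 hs.2 ht.2⟩

theorem isDartPath_map {E : Type*} (g : E → D) {l : List E} {p q : α} :
    IsDartPath s t p (l.map g) q ↔ IsDartPath (s ∘ g) (t ∘ g) p l q := by
  induction l generalizing p with
  | nil => rfl
  | cons x l ih => simp [IsDartPath, ih]

/-- The increments telescope; hence a piece of contour along which `c` sums to zero has the same
potential at both ends. -/
theorem IsDartPath.sum_eq {f g c : D → ℝ} {l : List D} {p q : ℝ} (h : IsDartPath f g p l q)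
    (hc : ∀ x ∈ l, g x = f x + c x) : q = p + (l.map c).sum := by
  induction l generalizing p with
  | nil => simpa [IsDartPath] using h.symm
  | cons x l ih =>
    simp only [List.forall_mem_cons] at hc
    rw [ih h.2 hc.2, hc.1, h.1, List.map_cons, List.sum_cons, add_assoc]

end DartPath

/-- The inverse of a letter. -/
def letterInv {X : Type*} (x : X × Bool) : X × Bool := (x.1, !x.2)

@[simp] theorem letterInv_letterInv {X : Type*} (x : X × Bool) : letterInv (letterInv x) = x := by
  simp [letterInv]

/-- The reduced word `l` represents an element of `R` or the inverse of one. -/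
def IsRelatorWord {X : Type*} (R : Set (FreeGroup X)) (l : List (X × Bool)) : Prop :=
  l ≠ [] ∧ FreeGroup.IsReduced l ∧ (FreeGroup.mk l ∈ R ∨ (FreeGroup.mk l)⁻¹ ∈ R)

/-- A planar map with outer contour labelled by `w`, with at most `A` cells labelled by relators.
Planarity is expressed cohomologically: every antisymmetric function `c` on darts whose sum along
each contour vanishes is the coboundary of a function `f` on vertices. A function on vertices is
given as a function on darts taking matching values along all contours. The bound `h` on the
distance of the vertices from the base point is expressed by means of Lipschitz functions.
The map need not be connected. -/
structure PlanarFilling {X : Type*} (R : Set (FreeGroup X)) (w : List (X × Bool)) (A h : ℕ) where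
  D : Type
  rev : D → D
  label : D → X × Bool
  outer : List D
  cells : List (List D)
  nodup : (outer ++ cells.flatten).Nodup
  rev_mem : ∀ y ∈ outer ++ cells.flatten, rev y ∈ outer ++ cells.flatten
  rev_rev : ∀ y ∈ outer ++ cells.flatten, rev (rev y) = y
  rev_ne : ∀ y ∈ outer ++ cells.flatten, rev y ≠ y
  label_rev : ∀ y ∈ outer ++ cells.flatten, label (rev y) = letterInv (label y)
  outer_label : outer.map label = w
  cell_label : ∀ l ∈ cells, IsRelatorWord R (l.map label)
  length_cells : cells.length ≤ A
  potential : ∀ c : D → ℝ, (∀ y ∈ outer ++ cells.flatten, c (rev y) = -c y) →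
    (outer.map c).sum = 0 → (∀ l ∈ cells, (l.map c).sum = 0) →
    ∃ (f : D → ℝ) (p : ℝ), IsDartPath f (f ∘ rev) p outer p ∧
      (∀ l ∈ cells, ∃ q, IsDartPath f (f ∘ rev) q l q) ∧
      (∀ y ∈ outer ++ cells.flatten, f (rev y) = f y + c y) ∧
      ((∀ y ∈ outer ++ cells.flatten, c y ≤ 1) → ∀ y ∈ outer ++ cells.flatten, f y ≤ p + h)

namespace PlanarFilling

variable {X : Type*} {R : Set (FreeGroup X)} {A h : ℕ}

/-- The filling of the empty word by a point. -/
def nil : PlanarFilling R [] A h where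
  D := Empty
  rev := id
  label := Empty.elim
  outer := []
  cells := []
  nodup := by simp
  rev_mem := by simp
  rev_rev := by simp
  rev_ne := by simp
  label_rev := by simp
  outer_label := rfl
  cell_label := by simp
  length_cells := by simp
  potential := fun c _ _ _ => ⟨0, 0, rfl, by simp, by simp, by simp⟩

/-- The bounds of a filling can be weakened. -/
def mono {w : List (X × Bool)} {A' h' : ℕ} (P : PlanarFilling R w A h) (hA : A ≤ A')
    (hh : h ≤ h') : PlanarFilling R w A' h' :=
  { P with
    length_cells := P.length_cells.trans hA
    potential := fun c h₁ h₂ h₃ => by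
      obtain ⟨f, p, h₁, h₂, h₃, h₄⟩ := P.potential c h₁ h₂ h₃
      refine ⟨f, p, h₁, h₂, h₃, fun hc y hy => (h₄ hc y hy).trans ?_⟩
      have : (h : ℝ) ≤ h' := by exact_mod_cast hh
      linarith }

theorem exists_outer_eq {w₁ w₂ : List (X × Bool)} (P : PlanarFilling R (w₁ ++ w₂) A h) :
    ∃ u v, P.outer = u ++ v ∧ u.map P.label = w₁ ∧ v.map P.label = w₂ :=
  List.map_eq_append_iff.1 P.outer_label

/-- Attaching a pendant edge to the outer contour. -/
theorem insert {w₁ w₂ : List (X × Bool)} (x : X × Bool) (hh : w₁.length + 1 ≤ h)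
    (P : PlanarFilling R (w₁ ++ w₂) A h) :
    Nonempty (PlanarFilling R (w₁ ++ x :: letterInv x :: w₂) A h) := by
  obtain ⟨u, v, huv, hu, hv⟩ := P.exists_outer_eq
  let i : P.D → P.D ⊕ Bool := Sum.inl
  let rev' : P.D ⊕ Bool → P.D ⊕ Bool := Sum.elim (i ∘ P.rev) (fun b => Sum.inr !b)
  have hmem : ∀ y, y ∈ (u.map i ++ Sum.inr true :: Sum.inr false :: v.map i) ++
      (P.cells.map (List.map i)).flatten ↔
      (∃ z ∈ P.outer ++ P.cells.flatten, i z = y) ∨ ∃ b, y = Sum.inr b := by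
    intro y
    rw [← List.map_flatten, huv]
    rcases y with y | _ | _ <;> simp [i]
  refine ⟨⟨P.D ⊕ Bool, rev', Sum.elim P.label fun b => cond b x (letterInv x),
    u.map i ++ Sum.inr true :: Sum.inr false :: v.map i, P.cells.map (List.map i),
    ?_, ?_, ?_, ?_, ?_, ?_, ?_, by simpa using P.length_cells, ?_⟩⟩
  · have h₀ := P.nodup
    rw [huv] at h₀
    have h₁ : ((Sum.inr true : P.D ⊕ Bool) :: Sum.inr false ::
        ((u ++ v) ++ P.cells.flatten).map i).Nodup := by
      simp only [List.nodup_cons, List.nodup_map_iff (show Function.Injective i from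
        Sum.inl_injective)]
      exact ⟨by simp [i], by simp [i], h₀⟩
    refine (List.Perm.nodup_iff ?_).1 h₁
    rw [← List.map_flatten, List.map_append, List.map_append, ← List.cons_append,
      ← List.cons_append]
    refine List.Perm.append_right _ ?_
    refine (List.perm_middle.symm.cons _).trans ?_
    exact List.perm_middle.symm
  · intro y hy
    rw [hmem] at hy ⊢
    rcases hy with ⟨z, hz, rfl⟩ | ⟨b, rfl⟩
    exacts [Or.inl ⟨_, P.rev_mem z hz, rfl⟩, Or.inr ⟨_, rfl⟩]
  · intro y hy
    rw [hmem] at hy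
    rcases hy with ⟨z, hz, rfl⟩ | ⟨b, rfl⟩
    exacts [congrArg i (P.rev_rev z hz), by simp [rev']]
  · intro y hy
    rw [hmem] at hy
    rcases hy with ⟨z, hz, rfl⟩ | ⟨b, rfl⟩
    exacts [fun h => P.rev_ne z hz (Sum.inl_injective h), by simp [rev']]
  · intro y hy
    rw [hmem] at hy
    rcases hy with ⟨z, hz, rfl⟩ | ⟨_ | _, rfl⟩
    exacts [P.label_rev z hz, by simp [rev'], by simp [rev']]
  · simp [i, Function.comp_def, hu, hv]
  · simp only [List.mem_map, forall_exists_index, and_imp, forall_apply_eq_imp_iff₂]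
    intro l hl
    simpa [i, Function.comp_def] using P.cell_label l hl
  · intro c hc ho hl
    have hc₁ : ∀ y ∈ P.outer ++ P.cells.flatten, c (i (P.rev y)) = -c (i y) := fun y hy =>
      hc (i y) ((hmem _).2 (Or.inl ⟨y, hy, rfl⟩))
    have hc₂ : c (Sum.inr false) = -c (Sum.inr true) :=
      hc (Sum.inr true) ((hmem _).2 (Or.inr ⟨_, rfl⟩))
    obtain ⟨f, p, h₁, h₂, h₃, h₄⟩ := P.potential (c ∘ i) hc₁
      (by simpa [huv, hc₂, Function.comp_def] using ho)
      (by simpa [Function.comp_def] using hl)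
    rw [huv, isDartPath_append] at h₁
    obtain ⟨r, h₁u, h₁v⟩ := h₁
    have hr := h₁u.sum_eq (c := c ∘ i) fun y hy => h₃ y (by simp [huv, hy])
    -- The dart `inr true` starts at the attaching vertex, of potential `r`; `inr false` starts at
    -- the new vertex, whose potential is forced by `c`.
    refine ⟨Sum.elim f fun b => cond b r (r + c (Sum.inr true)), p, ?_, ?_, ?_, ?_⟩
    · rw [isDartPath_append]
      refine ⟨r, (isDartPath_map i).2 h₁u, rfl, rfl, ?_⟩
      exact (isDartPath_map i).2 h₁v
    · simp only [List.mem_map, forall_exists_index, and_imp, forall_apply_eq_imp_iff₂]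
      intro l hl
      obtain ⟨q, hq⟩ := h₂ l hl
      exact ⟨q, (isDartPath_map i).2 hq⟩
    · intro y hy
      rw [hmem] at hy
      rcases hy with ⟨z, hz, rfl⟩ | ⟨_ | _, rfl⟩
      exacts [h₃ z hz, by simp [rev', hc₂], by simp [rev']]
    · intro hc1 y hy
      -- The attaching vertex is reached along `u`, so the new vertex is at most `w₁.length + 1`
      -- steps from the base point.
      have hcu : (u.map (c ∘ i)).sum ≤ w₁.length := by
        have := List.sum_le_card_nsmul (u.map (c ∘ i)) 1 (by
          simp only [List.mem_map, forall_exists_index, and_imp, forall_apply_eq_imp_iff₂]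
          exact fun a ha => hc1 _ ((hmem _).2 (Or.inl ⟨a, by simp [huv, ha], rfl⟩)))
        simpa [← hu] using this
      have hh' : (w₁.length : ℝ) + 1 ≤ h := by exact_mod_cast hh
      have hx := hc1 (Sum.inr true) ((hmem _).2 (Or.inr ⟨_, rfl⟩))
      rw [hmem] at hy
      rcases hy with ⟨z, hz, rfl⟩ | ⟨_ | _, rfl⟩
      · exact h₄ (fun y hy => hc1 _ ((hmem _).2 (Or.inl ⟨y, hy, rfl⟩))) z hz
      · simp only [Sum.elim_inr, cond_false]
        linarith
      · simp only [Sum.elim_inr, cond_true]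
        linarith

/-- Closing up a part of the outer contour to a new cell. -/
theorem pinch {w₁ r w₂ : List (X × Bool)} (hr : IsRelatorWord R r)
    (P : PlanarFilling R (w₁ ++ (r ++ w₂)) A h) :
    Nonempty (PlanarFilling R (w₁ ++ w₂) (A + 1) h) := by
  obtain ⟨u, yv, huv, hu, hyv⟩ := P.exists_outer_eq
  obtain ⟨y, v, rfl, hy, hv⟩ := List.map_eq_append_iff.1 hyv
  have hperm : (P.outer ++ P.cells.flatten).Perm ((u ++ v) ++ (y :: P.cells).flatten) := by
    rw [huv, List.flatten_cons, ← List.append_assoc (u ++ v)]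
    refine List.Perm.append_right _ ?_
    rw [List.append_assoc u]
    exact (List.perm_append_comm).append_left _
  have hmem := fun z => hperm.mem_iff (a := z)
  refine ⟨⟨P.D, P.rev, P.label, u ++ v, y :: P.cells, (hperm.nodup_iff).1 P.nodup, ?_, ?_, ?_, ?_,
    by simp [hu, hv], ?_, by simpa using P.length_cells, ?_⟩⟩
  · simpa only [← hmem] using P.rev_mem
  · simpa only [← hmem] using P.rev_rev
  · simpa only [← hmem] using P.rev_ne
  · simpa only [← hmem] using P.label_rev
  · simpa [hy] using ⟨hr, P.cell_label⟩
  · intro c hc ho hl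
    simp only [← hmem, List.forall_mem_cons] at hc hl ⊢
    obtain ⟨f, p, h₁, h₂, h₃, h₄⟩ := P.potential c hc (by
      simp only [List.map_append, List.sum_append] at ho
      simp [huv, hl.1, ho]) hl.2
    rw [huv] at h₁
    simp only [isDartPath_append] at h₁
    obtain ⟨a, h₁u, b, h₁y, h₁v⟩ := h₁
    -- As `c` sums to zero along the new cell, the two ends to be identified already have equal
    -- potential, and `f` serves unchanged.
    have hab := h₁y.sum_eq (c := c) fun z hz => h₃ z (by simp [huv, hz])
    rw [hl.1, add_zero] at hab
    subst hab
    exact ⟨f, p, isDartPath_append.2 ⟨b, h₁u, h₁v⟩, ⟨⟨b, h₁y⟩, h₂⟩, h₃, h₄⟩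

open Classical in
/-- Folding together two consecutive edges of the outer contour with inverse labels. -/
theorem fold {w₁ w₂ : List (X × Bool)} (x : X × Bool)
    (P : PlanarFilling R (w₁ ++ x :: letterInv x :: w₂) A h) :
    Nonempty (PlanarFilling R (w₁ ++ w₂) A h) := by
  obtain ⟨u, v₀, huv, hu, hv₀⟩ := P.exists_outer_eq
  obtain ⟨a, v₁, rfl, ha, hv₁⟩ := List.map_eq_cons_iff.1 hv₀
  obtain ⟨b, v, rfl, hb, hv⟩ := List.map_eq_cons_iff.1 hv₁
  have hperm : (P.outer ++ P.cells.flatten).Perm (a :: b :: ((u ++ v) ++ P.cells.flatten)) := by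
    rw [huv, ← List.cons_append, ← List.cons_append]
    refine List.Perm.append_right _ ?_
    exact List.perm_middle.trans (List.perm_middle.cons _)
  have hmem : ∀ z, z ∈ P.outer ++ P.cells.flatten ↔ z = a ∨ z = b ∨
      z ∈ (u ++ v) ++ P.cells.flatten := fun z => by
    rw [hperm.mem_iff, List.mem_cons, List.mem_cons]
  have hnodup := (hperm.nodup_iff).1 P.nodup
  have hab : a ≠ b := fun h => by simp [h] at hnodup
  have hne : ∀ z ∈ (u ++ v) ++ P.cells.flatten, z ≠ a ∧ z ≠ b := by
    rw [List.nodup_cons, List.nodup_cons] at hnodup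
    refine fun z hz => ⟨?_, ?_⟩
    · rintro rfl
      exact hnodup.1 (List.mem_cons_of_mem _ hz)
    · rintro rfl
      exact hnodup.2.1 hz
  have hnd : ((u ++ v) ++ P.cells.flatten).Nodup := hnodup.of_cons.of_cons
  clear hnodup hperm
  generalize hdarts : (u ++ v) ++ P.cells.flatten = darts at *
  have hmem' : ∀ z ∈ darts, z ∈ P.outer ++ P.cells.flatten := fun z hz =>
    (hmem z).2 (Or.inr (Or.inr hz))
  have hA : a ∈ P.outer ++ P.cells.flatten := (hmem a).2 (Or.inl rfl)
  have hB : b ∈ P.outer ++ P.cells.flatten := (hmem b).2 (Or.inr (Or.inl rfl))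
  have hraa := P.rev_rev a hA
  have hrbb := P.rev_rev b hB
  have hrna := P.rev_ne a hA
  have hrnb := P.rev_ne b hB
  -- Once `a` and `b` are deleted, their opposites become opposite to each other. If `P.rev a = b`,
  -- a pendant edge disappears and both special cases concern deleted darts only.
  let rev' : P.D → P.D := fun z =>
    if z = P.rev a then P.rev b else if z = P.rev b then P.rev a else P.rev z
  have hra : P.rev a ∈ darts ∨ P.rev a = b := by
    have := (hmem _).1 (P.rev_mem a hA)
    tauto
  have hrb : P.rev b ∈ darts ∨ P.rev b = a := by
    have := (hmem _).1 (P.rev_mem b hB)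
    tauto
  have hrab : P.rev a ≠ P.rev b := fun h => hab (by rw [← hraa, h, hrbb])
  have hrev' : ∀ z ∈ darts, (z = P.rev a ∧ rev' z = P.rev b ∧ P.rev b ∈ darts) ∨
      (z = P.rev b ∧ rev' z = P.rev a ∧ P.rev a ∈ darts) ∨
      (z ≠ P.rev a ∧ z ≠ P.rev b ∧ rev' z = P.rev z ∧ P.rev z ∈ darts) := by
    intro z hz
    by_cases h1 : z = P.rev a
    · refine Or.inl ⟨h1, by simp [rev', h1], hrb.resolve_right fun h2 => (hne z hz).2 ?_⟩
      rw [h1, ← h2, hrbb]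
    by_cases h2 : z = P.rev b
    · refine Or.inr (Or.inl ⟨h2, by simp [rev', h2, hrab.symm], hra.resolve_right fun h3 =>
        (hne z hz).1 ?_⟩)
      rw [h2, ← h3, hraa]
    · refine Or.inr (Or.inr ⟨h1, h2, by simp [rev', h1, h2], ?_⟩)
      rcases (hmem _).1 (P.rev_mem z (hmem' z hz)) with h3 | h3 | h3
      · exact absurd (by rw [← h3, P.rev_rev z (hmem' z hz)]) h1
      · exact absurd (by rw [← h3, P.rev_rev z (hmem' z hz)]) h2
      · exact h3
  have hrev'' : ∀ z ∈ darts, rev' (rev' z) = z := by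
    intro z hz
    rcases hrev' z hz with ⟨h1, h2, -⟩ | ⟨h1, h2, -⟩ | ⟨h1, h2, h3, -⟩
    · rw [h2, h1]; simp [rev', hrab.symm]
    · rw [h2, h1]; simp [rev']
    · have h4 := P.rev_rev z (hmem' z hz)
      have h5 : P.rev z ≠ P.rev a := fun h => (hne z hz).1 (by rw [← h4, h, hraa])
      have h6 : P.rev z ≠ P.rev b := fun h => (hne z hz).2 (by rw [← h4, h, hrbb])
      rw [h3]; simp [rev', h5, h6, h4]
  refine ⟨⟨P.D, rev', P.label, u ++ v, P.cells, hdarts ▸ hnd, ?_, ?_, ?_, ?_,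
    by simp [hu, hv], P.cell_label, P.length_cells, ?_⟩⟩
  · rw [hdarts]
    intro z hz
    rcases hrev' z hz with ⟨h1, h2, h3⟩ | ⟨h1, h2, h3⟩ | ⟨h1, h2, h3, h4⟩
    exacts [h2 ▸ h3, h2 ▸ h3, h3 ▸ h4]
  · rw [hdarts]
    exact hrev''
  · rw [hdarts]
    intro z hz
    rcases hrev' z hz with ⟨h1, h2, h3⟩ | ⟨h1, h2, h3⟩ | ⟨h1, h2, h3, h4⟩
    · rw [h2, h1]; exact hrab.symm
    · rw [h2, h1]; exact hrab
    · rw [h3]; exact P.rev_ne z (hmem' z hz)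
  · rw [hdarts]
    intro z hz
    rcases hrev' z hz with ⟨h1, h2, h3⟩ | ⟨h1, h2, h3⟩ | ⟨h1, h2, h3, h4⟩
    · rw [h2, h1, P.label_rev a hA, P.label_rev b hB, ha, hb]
    · rw [h2, h1, P.label_rev a hA, P.label_rev b hB, ha, hb, letterInv_letterInv]
    · rw [h3]; exact P.label_rev z (hmem' z hz)
  · rw [hdarts]
    intro c hc ho hl
    -- `c` is extended to the deleted darts by antisymmetry, or by zero on a pendant edge.
    let c' : P.D → ℝ := fun z =>
      if z = a then (if P.rev a = b then 0 else -c (P.rev a)) else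
      if z = b then (if P.rev a = b then 0 else -c (P.rev b)) else c z
    have hc'1 : ∀ z ∈ darts, c' z = c z := fun z hz => by
      simp [c', (hne z hz).1, (hne z hz).2]
    have hsum : c' a + c' b = 0 := by
      by_cases h : P.rev a = b
      · simp [c', hab.symm, h]
      · have h3 := hra.resolve_right h
        have h4 := hc _ h3
        have h5 : rev' (P.rev a) = P.rev b := by simp [rev']
        rw [h5] at h4
        simp [c', hab.symm, h, h4]
    have hc'a : c' (P.rev a) = -c' a := by
      by_cases h : P.rev a = b
      · rw [h]; linarith
      · rw [hc'1 _ (hra.resolve_right h)]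
        simp [c', h]
    have hc'b : c' (P.rev b) = -c' b := by
      by_cases h : P.rev a = b
      · rw [← h, hraa, h]; linarith
      · have h' : P.rev b ≠ a := fun h' => h (by rw [← h', hrbb])
        rw [hc'1 _ (hrb.resolve_right h')]
        simp [c', h, hab.symm]
    have hc' : ∀ z ∈ P.outer ++ P.cells.flatten, c' (P.rev z) = -c' z := by
      intro z hz
      rcases (hmem z).1 hz with rfl | rfl | hz'
      · exact hc'a
      · exact hc'b
      · rcases hrev' z hz' with ⟨h1, h2, h3⟩ | ⟨h1, h2, h3⟩ | ⟨h1, h2, h3, h4⟩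
        · rw [h1, hraa, hc'a, neg_neg]
        · rw [h1, hrbb, hc'b, neg_neg]
        · rw [hc'1 _ h4, hc'1 _ hz', ← h3, hc z hz']
    have hcong : ∀ l : List P.D, (∀ z ∈ l, z ∈ darts) → l.map c' = l.map c := fun l hl =>
      List.map_congr_left fun z hz => hc'1 z (hl z hz)
    have hud : ∀ z ∈ u, z ∈ darts := fun z hz => by rw [← hdarts]; simp [hz]
    have hvd : ∀ z ∈ v, z ∈ darts := fun z hz => by rw [← hdarts]; simp [hz]
    have hcd : ∀ l ∈ P.cells, ∀ z ∈ l, z ∈ darts := fun l hl z hz => by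
      rw [← hdarts]
      exact List.mem_append_right _ (List.mem_flatten.2 ⟨l, hl, hz⟩)
    obtain ⟨f, p, h₁, h₂, h₃, h₄⟩ := P.potential c' hc' (by
      rw [List.map_append, List.sum_append] at ho
      rw [huv, List.map_append, List.map_cons, List.map_cons, hcong u hud, hcong v hvd]
      simp only [List.sum_append, List.sum_cons]
      linarith) fun l hl' => by
        rw [hcong l (hcd l hl')]
        exact hl l hl'
    rw [huv] at h₁
    simp only [isDartPath_append, IsDartPath, Function.comp_apply] at h₁
    obtain ⟨s, h₁u, hfa, hfb, h₁v⟩ := h₁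
    have ea := h₃ a hA
    have eb := h₃ b hB
    -- The increments over `a` and `b` cancel, so the contour remains a path when these darts are
    -- dropped, and the old `f` serves again.
    have hs : f (P.rev b) = s := by linarith
    rw [hs] at h₁v
    have hfrev : ∀ z ∈ darts, f (rev' z) = f (P.rev z) := by
      intro z hz
      rcases hrev' z hz with ⟨h1, h2, h3⟩ | ⟨h1, h2, h3⟩ | ⟨h1, h2, h3, h4⟩
      · rw [h2, h1, hraa, hs, hfa]
      · rw [h2, h1, hrbb, hfb]
      · rw [h3]
    refine ⟨f, p, isDartPath_append.2 ⟨s, h₁u.congr (fun _ _ => rfl) fun z hz =>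
      hfrev z (hud z hz), h₁v.congr (fun _ _ => rfl) fun z hz => hfrev z (hvd z hz)⟩, ?_, ?_, ?_⟩
    · intro l hl'
      obtain ⟨q, hq⟩ := h₂ l hl'
      exact ⟨q, hq.congr (fun _ _ => rfl) fun z hz => hfrev z (hcd l hl' z hz)⟩
    · intro z hz
      rw [hfrev z hz, h₃ z (hmem' z hz), hc'1 z hz]
    · intro hc1 z hz
      refine h₄ (fun y hy => ?_) z (hmem' z hz)
      rcases (hmem y).1 hy with rfl | rfl | hy'
      · by_cases h : P.rev y = b
        · simp [c', h]
        · have h3 := hrb.resolve_right fun h' => h (by rw [← h', hrbb])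
          have h4 := hc'b
          rw [hc'1 _ h3] at h4
          linarith [hc1 _ h3]
      · by_cases h : P.rev a = y
        · simp [c', h]
        · have h3 := hra.resolve_right h
          have h4 := hc'a
          rw [hc'1 _ h3] at h4
          linarith [hc1 _ h3]
      · rw [hc'1 y hy']
        exact hc1 y hy'

end PlanarFilling

/-! ## Products of conjugates -/

/-- `g` is a product of `A` conjugates `x * t * x⁻¹` of elements `t` of `T ∪ T⁻¹`, with conjugating
elements `x` of length at most `h`. -/
inductive IsConjProd {X : Type*} [DecidableEq X] (T : Set (FreeGroup X)) (h : ℕ) :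
    ℕ → FreeGroup X → Prop
  | one : IsConjProd T h 0 1
  | mul {A : ℕ} {g x t : FreeGroup X} : x.norm ≤ h → (t ∈ T ∨ t⁻¹ ∈ T) → IsConjProd T h A g →
      IsConjProd T h (A + 1) (x * t * x⁻¹ * g)

namespace IsConjProd

variable {X : Type*} [DecidableEq X] {T : Set (FreeGroup X)} {h h' A B : ℕ} {g g' : FreeGroup X}

theorem mono_right (H : IsConjProd T h A g) (hh : h ≤ h') : IsConjProd T h' A g := by
  induction H with
  | one => exact .one
  | mul hx ht _ ih => exact .mul (hx.trans hh) ht ih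

theorem mul' (H : IsConjProd T h A g) (H' : IsConjProd T h B g') :
    IsConjProd T h (A + B) (g * g') := by
  induction H with
  | one => simpa using H'
  | mul hx ht _ ih =>
    rw [mul_assoc, Nat.succ_add]
    exact .mul hx ht ih

theorem conj (x : FreeGroup X) (H : IsConjProd T h A g) :
    IsConjProd T (x.norm + h) A (x * g * x⁻¹) := by
  induction H with
  | one => simpa using .one
  | @mul A g y t hy ht _ ih =>
    have := IsConjProd.mul ((FreeGroup.norm_mul_le x y).trans (Nat.add_le_add_left hy _)) ht ih
    convert this using 1
    group

theorem of_mem {t : FreeGroup X} (ht : t ∈ T ∨ t⁻¹ ∈ T) : IsConjProd T h 1 t := by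
  simpa using IsConjProd.mul (x := 1) (h := h) (by simp) ht .one

theorem inv (H : IsConjProd T h A g) : IsConjProd T h A g⁻¹ := by
  induction H with
  | one => simpa using .one
  | @mul A g x t hx ht _ ih =>
    have ht' : t⁻¹ ∈ T ∨ t⁻¹⁻¹ ∈ T := by simpa [or_comm] using ht
    simpa [mul_assoc] using ih.mul' (IsConjProd.mul hx ht' .one)

/-- Under substitution the numbers of factors multiply, whereas the conjugator lengths only add.
This is why repeated halving gives polynomial area but linear diameter. -/
theorem subst {U : Set (FreeGroup X)} (H : IsConjProd T h A g)
    (hT : ∀ t ∈ T, ∃ B' ≤ B, IsConjProd U h' B' t) :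
    ∃ B' ≤ A * B, IsConjProd U (h + h') B' g := by
  induction H with
  | one => exact ⟨0, by simp, .one⟩
  | @mul A g x t hx ht _ ih =>
    obtain ⟨B₁, hB₁, h₁⟩ := ih
    obtain ⟨B₂, hB₂, h₂⟩ : ∃ B' ≤ B, IsConjProd U h' B' t := by
      rcases ht with ht | ht
      · exact hT t ht
      · obtain ⟨B', hB', h₁⟩ := hT _ ht
        exact ⟨B', hB', by simpa using h₁.inv⟩
    exact ⟨B₂ + B₁, by rw [Nat.succ_mul]; omega,
      ((h₂.conj x).mono_right (Nat.add_le_add_right hx _)).mul' h₁⟩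

theorem mem_normalClosure (H : IsConjProd T h A g) : g ∈ Subgroup.normalClosure T := by
  induction H with
  | one => exact one_mem _
  | @mul A g x t hx ht _ ih =>
    refine mul_mem (Subgroup.normalClosure_normal.conj_mem _ ?_ x) ih
    rcases ht with ht | ht
    · exact Subgroup.subset_normalClosure ht
    · exact inv_mem_iff.1 (Subgroup.subset_normalClosure ht)

/-- Neither number is controlled; this suffices for the finitely many short words at which halving
stops. -/
theorem exists_of_mem_normalClosure (hg : g ∈ Subgroup.normalClosure T) :
    ∃ h A, IsConjProd T h A g := by
  refine Subgroup.closure_induction (p := fun g _ => ∃ h A, IsConjProd T h A g) ?_ ?_ ?_ ?_ hg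
  · intro y hy
    obtain ⟨t, ht, hty⟩ := Group.mem_conjugatesOfSet_iff.1 hy
    obtain ⟨x, rfl⟩ := isConj_iff.1 hty
    exact ⟨_, 1, (of_mem (h := 0) (Or.inl ht)).conj x⟩
  · exact ⟨0, 0, .one⟩
  · rintro x y - - ⟨h₁, A₁, H₁⟩ ⟨h₂, A₂, H₂⟩
    exact ⟨max h₁ h₂, A₁ + A₂,
      (H₁.mono_right (le_max_left _ _)).mul' (H₂.mono_right (le_max_right _ _))⟩
  · rintro x - ⟨h₁, A₁, H₁⟩
    exact ⟨h₁, A₁, H₁.inv⟩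

end IsConjProd

/-! ### Fillings of products of conjugates. -/

namespace PlanarFilling

variable {X : Type*} {R : Set (FreeGroup X)} {A h : ℕ}

/-- Attaching a pendant path to the outer contour. -/
theorem insert_invRev {w₁ w₂ t : List (X × Bool)} (hh : w₁.length + t.length ≤ h)
    (P : PlanarFilling R (w₁ ++ w₂) A h) :
    Nonempty (PlanarFilling R (w₁ ++ (t ++ (FreeGroup.invRev t ++ w₂))) A h) := by
  induction t generalizing w₁ w₂ with
  | nil => exact ⟨by simpa using P⟩
  | cons x t ih =>
    simp only [List.length_cons] at hh
    obtain ⟨P₁⟩ := P.insert x (by omega)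
    obtain ⟨P₂⟩ := ih (w₁ := w₁ ++ [x]) (w₂ := letterInv x :: w₂)
      (by simp only [List.length_append, List.length_cons, List.length_nil]; omega)
      (by simpa using P₁)
    exact ⟨by simpa [FreeGroup.invRev, letterInv] using P₂⟩

/-- Each cancellation is a fold, which costs neither cells nor height. -/
theorem of_red {w w' : List (X × Bool)} (hw : FreeGroup.Red w w')
    (H : Nonempty (PlanarFilling R w A h)) : Nonempty (PlanarFilling R w' A h) := by
  induction hw with
  | refl => exact H
  | tail _ hs ih =>
    obtain ⟨P⟩ := ih
    obtain @⟨u, v, x, b⟩ := hs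
    exact P.fold (x, b)

/-- Undoing a cancellation attaches a pendant edge, and the new vertex is reached along a prefix of
the longer word; hence the condition `hh`. -/
theorem of_red' {w w' : List (X × Bool)} (hw : FreeGroup.Red w w') (hh : w.length ≤ h)
    (H : Nonempty (PlanarFilling R w' A h)) : Nonempty (PlanarFilling R w A h) := by
  induction hw using Relation.ReflTransGen.head_induction_on with
  | refl => exact H
  | head hs _ ih =>
    obtain @⟨u, v, x, b⟩ := hs
    simp only [List.length_append, List.length_cons] at hh ih
    obtain ⟨P⟩ := ih (by omega)
    exact P.insert (x, b) (by omega)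

/-- A factor `x * t * x⁻¹` is added by growing the contour `x t t⁻¹ x⁻¹` at the base point and
closing up its segment `t⁻¹` to a cell. The new vertices are within `x.norm + t.norm ≤ h + M` of the
base point. -/
theorem of_isConjProd [DecidableEq X] {g : FreeGroup X} {M : ℕ} (hR : ∀ r ∈ R, r.norm ≤ M)
    (H : IsConjProd R h A g) :
    ∃ w, FreeGroup.mk w = g ∧ Nonempty (PlanarFilling R w A (h + M)) := by
  induction H with
  | one => exact ⟨[], rfl, ⟨nil⟩⟩
  | @mul A g x t hx ht _ ih =>
    obtain ⟨w, rfl, ⟨P⟩⟩ := ih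
    -- A trivial relator is skipped, because relator words are nonempty; `A` is only an upper bound
    -- for the number of cells.
    rcases eq_or_ne t 1 with rfl | ht₁
    · exact ⟨w, by simp, ⟨P.mono (Nat.le_succ A) le_rfl⟩⟩
    have htM : t.norm ≤ M := by
      rcases ht with ht | ht
      exacts [hR t ht, by simpa using hR _ ht]
    obtain ⟨P₁⟩ := P.insert_invRev (w₁ := []) (w₂ := w) (t := x.toWord)
      (by simpa [FreeGroup.norm] using Nat.le_add_right_of_le (k := M) hx)
    obtain ⟨P₂⟩ := P₁.insert_invRev (w₁ := x.toWord) (t := t.toWord)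
      (by simpa [FreeGroup.norm] using Nat.add_le_add hx htM)
    have hrel : IsRelatorWord R (FreeGroup.invRev t.toWord) := by
      rw [← FreeGroup.toWord_inv]
      refine ⟨by rwa [Ne, FreeGroup.toWord_eq_nil_iff, inv_eq_one], FreeGroup.isReduced_toWord, ?_⟩
      rw [FreeGroup.mk_toWord, inv_inv]
      exact ht.symm
    rw [← List.append_assoc] at P₂
    obtain ⟨P₃⟩ := P₂.pinch hrel
    refine ⟨_, ?_, ⟨P₃⟩⟩
    simp only [← FreeGroup.mul_mk, ← FreeGroup.inv_mk, FreeGroup.mk_toWord, mul_assoc]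

/-- A product of conjugates of relators is the boundary label of a planar filling. -/
theorem exists_of_isConjProd [DecidableEq X] {w : List (X × Bool)} {M : ℕ}
    (hR : ∀ r ∈ R, r.norm ≤ M) (H : IsConjProd R h A (FreeGroup.mk w)) :
    Nonempty (PlanarFilling R w A (max (h + M) w.length)) := by
  obtain ⟨w', hw', ⟨P⟩⟩ := of_isConjProd hR H
  -- The two words have a common reduct `v`: fold `w'` down to it, then grow pendant edges up to
  -- `w`.
  obtain ⟨v, h₁, h₂⟩ := FreeGroup.Red.exact.1 hw'
  exact of_red' h₂ (le_max_right _ _) (of_red h₁ ⟨P.mono le_rfl (le_max_left _ _)⟩)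

end PlanarFilling

/-! ## Connected planar fillings -/

theorem List.prod_map_formPerm_apply_of_notMem {α : Type*} [DecidableEq α] {F : List (List α)}
    {y : α} (hy : y ∉ F.flatten) : (F.map List.formPerm).prod y = y := by
  induction F with
  | nil => simp
  | cons m F ih =>
    simp only [List.flatten_cons, List.mem_append, not_or] at hy
    rw [List.map_cons, List.prod_cons, Equiv.Perm.mul_apply, ih hy.2,
      List.formPerm_apply_of_notMem hy.1]

/-- The lists are disjoint, so a dart and its image are moved by the same single factor. -/
theorem List.prod_map_formPerm_apply {α : Type*} [DecidableEq α] {F : List (List α)}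
    (hF : F.flatten.Nodup) {l : List α} (hl : l ∈ F) {y : α} (hy : y ∈ l) :
    (F.map List.formPerm).prod y = l.formPerm y := by
  induction F with
  | nil => simp at hl
  | cons m F ih =>
    rw [List.flatten_cons, List.nodup_append'] at hF
    rw [List.map_cons, List.prod_cons, Equiv.Perm.mul_apply]
    rcases List.mem_cons.1 hl with rfl | hl
    · rw [List.prod_map_formPerm_apply_of_notMem fun h => hF.2.2 hy h]
    · rw [ih hF.2.1 hl]
      refine List.formPerm_apply_of_notMem fun h => hF.2.2 h (List.mem_flatten.2 ⟨l, hl, ?_⟩)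
      exact List.formPerm_mem_iff_mem.2 hy

theorem IsDartPath.target_getElem {D α : Type*} {s t : D → α} {l : List D} {p q : α}
    (h : IsDartPath s t p l q) (i : ℕ) (hi : i < l.length) :
    t l[i] = if h : i + 1 < l.length then s l[i + 1] else q := by
  induction l generalizing p i with
  | nil => simp at hi
  | cons x l ih =>
    cases i with
    | zero =>
      cases l with
      | nil => simpa [IsDartPath] using h.2
      | cons z l => simpa using h.2.1.symm
    | succ i => simpa using ih h.2 i (by simpa using hi)

/-- Turns a closed path along a list into a local condition on the successor permutation; closedness
is what handles the wrap-around at the last dart. -/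
theorem IsDartPath.source_formPerm {D α : Type*} [DecidableEq D] {s t : D → α} {l : List D} {p : α}
    (h : IsDartPath s t p l p) (hl : l.Nodup) {y : D} (hy : y ∈ l) : s (l.formPerm y) = t y := by
  obtain ⟨i, hi, rfl⟩ := List.getElem_of_mem hy
  rw [List.formPerm_apply_getElem _ hl, h.target_getElem i hi]
  split_ifs with h'
  · simp [Nat.mod_eq_of_lt h']
  · have hil : i + 1 = l.length := by omega
    cases l with
    | nil => simp at hi
    | cons x l =>
      simpa [hil] using h.1

/-- Since `l` has no repetitions, the period is exactly `l.length`: a smaller one would repeat an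
entry. -/
theorem map_range_minimalPeriod {D E : Type*} {f : D → D} {a : D} {g : D → E}
    (hg : Function.Injective g) {l : List E} (hl : l.Nodup) (h₀ : l ≠ [])
    (h : ∀ k, g (f^[k] a) = l[k % l.length]'(Nat.mod_lt _ (List.length_pos_iff.2 h₀))) :
    (List.range (Function.minimalPeriod f a)).map (fun i => g (f^[i] a)) = l := by
  have hpos := List.length_pos_iff.2 h₀
  have hper : Function.IsPeriodicPt f l.length a := hg <| by
    rw [h, ← Function.iterate_zero_apply f a, h]
    simp
  have hmin : Function.minimalPeriod f a = l.length := by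
    refine le_antisymm (hper.minimalPeriod_le hpos) (not_lt.1 fun hlt => ?_)
    have h₁ : 0 < Function.minimalPeriod f a := hper.minimalPeriod_pos hpos
    have h₂ := h (Function.minimalPeriod f a)
    have h₃ := h 0
    rw [Function.iterate_minimalPeriod] at h₂
    rw [Function.iterate_zero_apply, h₂, hl.getElem_inj_iff, Nat.mod_eq_of_lt hlt] at h₃
    simp at h₃
    omega
  rw [hmin]
  refine List.ext_getElem (by simp) fun i h₁ h₂ => ?_
  simp [h, Nat.mod_eq_of_lt h₂]

/-- The label of the contour of a face, read from the dart `a`. -/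
noncomputable def contourLabel {D L : Type*} (next : D → D) (label : D → L) (a : D) : List L :=
  (List.range (Function.minimalPeriod next a)).map fun i => label (next^[i] a)

/-- A connected planar map given by permutations of a finite set of darts, with planarity and the
bound `h` on distances expressed as in `PlanarFilling`. -/
structure PermFilling {X : Type*} (R : Set (FreeGroup X)) (w : List (X × Bool)) (A h : ℕ) where
  D : Type
  [fintype : Fintype D]
  rev : Equiv.Perm D
  next : Equiv.Perm D
  label : D → X × Bool
  root : D
  cellRoots : Finset D
  rev_rev : ∀ y, rev (rev y) = y
  rev_ne : ∀ y, rev y ≠ y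
  label_rev : ∀ y, label (rev y) = letterInv (label y)
  root_label : contourLabel next label root = w
  cell_label : ∀ a ∈ cellRoots, IsRelatorWord R (contourLabel next label a)
  card_cellRoots : cellRoots.card ≤ A
  cover : ∀ y, next.SameCycle root y ∨ ∃ a ∈ cellRoots, next.SameCycle a y
  conn : ∀ K : Set D, root ∈ K → (∀ y ∈ K, rev y ∈ K) → (∀ y ∈ K, next y ∈ K) → ∀ y, y ∈ K
  potential : ∀ c : D → ℝ, (∀ y, c (rev y) = -c y) →
    (∀ g : D → ℝ, (∀ y, g (next y) = g y) → ∑ y, g y * c y = 0) →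
    ∃ f : D → ℝ, (∀ y, f (next y) = f (rev y)) ∧ (∀ y, f (rev y) = f y + c y) ∧
      ((∀ y, c y ≤ 1) → ∀ y, f y ≤ f root + h)

/-! ### Passing to the component of the outer contour. -/

namespace PlanarFilling

variable {X : Type*} {R : Set (FreeGroup X)} {w : List (X × Bool)} {A h : ℕ}

/-- The darts in the component of the outer contour. -/
inductive IsLive (P : PlanarFilling R w A h) : P.D → Prop
  | outer {y : P.D} : y ∈ P.outer → P.IsLive y
  | rev {y : P.D} : P.IsLive y → P.IsLive (P.rev y)
  | cell {y z : P.D} {l : List P.D} : l ∈ P.cells → y ∈ l → z ∈ l → P.IsLive y → P.IsLive z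

theorem IsLive.mem {P : PlanarFilling R w A h} {y : P.D} (hy : P.IsLive y) :
    y ∈ (P.outer :: P.cells).flatten := by
  induction hy with
  | outer h => simp [h]
  | rev _ ih => exact P.rev_mem _ ih
  | cell hl _ hz _ _ => exact List.mem_flatten.2 ⟨_, List.mem_cons_of_mem _ hl, hz⟩

theorem IsLive.of_mem {P : PlanarFilling R w A h} {y z : P.D} {l : List P.D}
    (hl : l ∈ P.outer :: P.cells) (hy : y ∈ l) (hz : z ∈ l) (h : P.IsLive y) : P.IsLive z := by
  rcases List.mem_cons.1 hl with rfl | hl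
  exacts [.outer hz, .cell hl hy hz h]

open Classical in
/-- The successor of a dart on the contour of its face. -/
noncomputable def next (P : PlanarFilling R w A h) : Equiv.Perm P.D :=
  ((P.outer :: P.cells).map List.formPerm).prod

variable (P : PlanarFilling R w A h)

theorem nodup' : (P.outer :: P.cells).flatten.Nodup := P.nodup

theorem nodup_of_mem {l : List P.D} (hl : l ∈ P.outer :: P.cells) : l.Nodup :=
  (List.nodup_flatten.1 P.nodup').1 l hl

open Classical in
theorem next_apply {l : List P.D} (hl : l ∈ P.outer :: P.cells) {y : P.D} (hy : y ∈ l) :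
    P.next y = l.formPerm y :=
  List.prod_map_formPerm_apply P.nodup' hl hy

theorem next_mem {l : List P.D} (hl : l ∈ P.outer :: P.cells) {y : P.D} :
    P.next y ∈ l ↔ y ∈ l := by
  classical
  refine ⟨fun h => ?_, fun h => ?_⟩
  · have h₁ : l.formPerm (l.formPerm.symm (P.next y)) = P.next y := Equiv.apply_symm_apply _ _
    have h₂ : l.formPerm.symm (P.next y) ∈ l := by
      rw [← List.formPerm_mem_iff_mem, h₁]
      exact h
    rw [← P.next_apply hl h₂] at h₁
    rwa [← P.next.injective h₁]
  · rw [P.next_apply hl h]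
    exact List.formPerm_mem_iff_mem.2 h

theorem next_iterate {l : List P.D} (hl : l ∈ P.outer :: P.cells) (i : ℕ) (hi : i < l.length)
    (k : ℕ) : P.next^[k] l[i] = l[(i + k) % l.length]'(Nat.mod_lt _ (Nat.zero_lt_of_lt hi)) := by
  classical
  induction k with
  | zero => simp [Nat.mod_eq_of_lt hi]
  | succ k ih =>
    rw [Function.iterate_succ_apply', ih, P.next_apply hl (List.getElem_mem _),
      List.formPerm_apply_getElem _ (P.nodup_of_mem hl)]
    simp [add_assoc]

theorem exists_next_iterate {l : List P.D} (hl : l ∈ P.outer :: P.cells) {y z : P.D} (hy : y ∈ l)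
    (hz : z ∈ l) : ∃ k, P.next^[k] y = z := by
  obtain ⟨i, hi, rfl⟩ := List.getElem_of_mem hy
  obtain ⟨j, hj, rfl⟩ := List.getElem_of_mem hz
  refine ⟨l.length - i + j, ?_⟩
  rw [P.next_iterate hl i hi]
  congr 1
  rw [← add_assoc, Nat.add_sub_cancel' hi.le, Nat.add_mod_left, Nat.mod_eq_of_lt hj]

theorem isLive_next {y : P.D} : P.IsLive (P.next y) ↔ P.IsLive y := by
  classical
  by_cases hy : y ∈ (P.outer :: P.cells).flatten
  · obtain ⟨l, hl, hyl⟩ := List.mem_flatten.1 hy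
    have := (P.next_mem hl).2 hyl
    exact ⟨fun h => h.of_mem hl this hyl, fun h => h.of_mem hl hyl this⟩
  · rw [next, List.prod_map_formPerm_apply_of_notMem hy]

theorem isLive_rev {y : P.D} (hy : P.IsLive y) : P.rev (P.rev y) = y := P.rev_rev y hy.mem

open Classical in
/-- The component of the outer contour. -/
theorem exists_permFilling (P : PlanarFilling R w A h) (hw : w ≠ []) : Nonempty (PermFilling R w A h) := by
  -- Folding may split off components, so only darts linked to the outer contour are kept.
  let K : Finset P.D := (P.outer :: P.cells).flatten.toFinset.filter P.IsLive
  have hK : ∀ {y}, y ∈ K ↔ P.IsLive y := fun {y} => by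
    simp only [K, Finset.mem_filter, List.mem_toFinset, and_iff_right_iff_imp]
    exact IsLive.mem
  have ho : P.outer ≠ [] := fun h => hw (by rw [← P.outer_label, h, List.map_nil])
  have hno : P.outer ∈ P.outer :: P.cells := List.mem_cons_self
  let rev' : K → K := fun y => ⟨P.rev y, hK.2 (.rev (hK.1 y.2))⟩
  have hrev' : Function.Involutive rev' := fun y => Subtype.ext (P.isLive_rev (hK.1 y.2))
  let next' : Equiv.Perm K := P.next.subtypePerm fun y => by rw [hK, hK, P.isLive_next]
  have hnext' : ∀ k (y : K), ((next'^[k] y : K) : P.D) = P.next^[k] y := by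
    intro k
    induction k with
    | zero => simp
    | succ k ih => intro y; rw [Function.iterate_succ_apply, Function.iterate_succ_apply, ih]; rfl
  have hcycle : ∀ {y z : K} {l}, l ∈ P.outer :: P.cells → y.1 ∈ l → z.1 ∈ l →
      ∃ k : ℕ, next'^[k] y = z := by
    intro y z l hl hy hz
    obtain ⟨k, hk⟩ := P.exists_next_iterate hl hy hz
    exact ⟨k, Subtype.ext (by rw [hnext', hk])⟩
  have hsame : ∀ {y z : K} {l}, l ∈ P.outer :: P.cells → y.1 ∈ l → z.1 ∈ l →
      next'.SameCycle y z := by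
    intro y z l hl hy hz
    obtain ⟨k, hk⟩ := hcycle hl hy hz
    exact ⟨k, by rw [zpow_natCast, Equiv.Perm.coe_pow]; exact hk⟩
  have hcontour : ∀ {l} (hl : l ∈ P.outer :: P.cells) (h₀ : l ≠ []) (a : K),
      a.1 = l.head h₀ → contourLabel next' (fun y : K => P.label y) a = l.map P.label := by
    intro l hl h₀ a ha
    have := map_range_minimalPeriod (f := next') (a := a) Subtype.val_injective
      (P.nodup_of_mem hl) h₀ fun k => by
        rw [hnext', ha, List.head_eq_getElem, P.next_iterate hl]
        simp
    conv_rhs => rw [← this]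
    simp [contourLabel]
  let root : K := ⟨P.outer.head ho, hK.2 (.outer (List.head_mem ho))⟩
  let roots : Finset K := Finset.univ.filter fun y => ∃ l ∈ P.cells, l.head? = some y.1
  refine ⟨⟨K, hrev'.toPerm, next', fun y => P.label y, root, roots, hrev', ?_, ?_, ?_, ?_, ?_, ?_,
    ?_, ?_⟩⟩
  · exact fun y h => P.rev_ne y (hK.1 y.2).mem (congrArg Subtype.val h)
  · exact fun y => P.label_rev y (hK.1 y.2).mem
  · exact (hcontour hno ho _ rfl).trans P.outer_label
  · intro a ha
    obtain ⟨l, hl, hla⟩ := (Finset.mem_filter.1 ha).2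
    have h₀ : l ≠ [] := by rintro rfl; simp at hla
    rw [hcontour (List.mem_cons_of_mem _ hl) h₀ a (by
      rw [List.head?_eq_some_head h₀] at hla
      exact (Option.some.inj hla).symm)]
    exact P.cell_label l hl
  · rw [← Finset.card_map (Function.Embedding.subtype _)]
    refine le_trans (Finset.card_le_card (t := (P.cells.filterMap List.head?).toFinset) ?_)
      ((List.toFinset_card_le _).trans ((List.length_filterMap_le _ _).trans P.length_cells))
    intro y hy
    obtain ⟨a, ha, rfl⟩ := Finset.mem_map.1 hy
    obtain ⟨l, hl, hla⟩ := (Finset.mem_filter.1 ha).2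
    exact List.mem_toFinset.2 (List.mem_filterMap.2 ⟨l, hl, hla⟩)
  · intro y
    obtain ⟨l, hl, hyl⟩ := List.mem_flatten.1 (hK.1 y.2).mem
    rcases List.mem_cons.1 hl with rfl | hl'
    · exact Or.inl (hsame hl (List.head_mem ho) hyl)
    · have h₀ := List.ne_nil_of_mem hyl
      refine Or.inr ⟨⟨l.head h₀, hK.2 ((hK.1 y.2).of_mem hl hyl (List.head_mem h₀))⟩, ?_, ?_⟩
      · exact Finset.mem_filter.2 ⟨Finset.mem_univ _, l, hl', List.head?_eq_some_head h₀⟩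
      · exact hsame hl (List.head_mem h₀) hyl
  · intro S hS₀ hSrev hSnext
    have hit : ∀ k, ∀ y ∈ S, next'^[k] y ∈ S := by
      intro k
      induction k with
      | zero => exact fun y hy => hy
      | succ k ih =>
        intro y hy
        rw [Function.iterate_succ_apply']
        exact hSnext _ (ih y hy)
    have key : ∀ y, P.IsLive y → ∀ hy : y ∈ K, (⟨y, hy⟩ : K) ∈ S := by
      intro y hy
      induction hy with
      | outer h =>
        intro hy
        obtain ⟨k, hk⟩ := hcycle (y := root) (z := ⟨_, hy⟩) hno (List.head_mem ho) h
        exact hk ▸ hit k _ hS₀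
      | rev hy ih => exact fun _ => hSrev _ (ih (hK.2 hy))
      | cell hl hyl hzl hy ih =>
        intro hz
        obtain ⟨k, hk⟩ := hcycle (y := ⟨_, hK.2 hy⟩) (z := ⟨_, hz⟩)
          (List.mem_cons_of_mem _ hl) hyl hzl
        exact hk ▸ hit k _ (ih _)
    exact fun y => key y (hK.1 y.2) y.2
  · intro c hc hg
    -- Extended by zero, `c` satisfies the hypotheses of `P.potential` on the discarded components
    -- too.
    let c' : P.D → ℝ := fun y => if hy : y ∈ K then c ⟨y, hy⟩ else 0
    have hc' : ∀ y : K, c' y = c y := fun y => by simp [c']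
    have hsum : ∀ l ∈ P.outer :: P.cells, (l.map c').sum = 0 := by
      intro l hl
      rw [← List.sum_toFinset _ (P.nodup_of_mem hl),
        ← Finset.sum_subset (s₁ := K.filter (· ∈ l)) (fun y hy => by
          simpa using (Finset.mem_filter.1 hy).2) fun y hy hy' => by
          have : y ∉ K := fun h => hy' (Finset.mem_filter.2 ⟨h, by simpa using hy⟩)
          exact dif_neg this, Finset.sum_filter, ← Finset.sum_coe_sort K]
      -- The indicator of a contour is invariant under `next'`; testing against it recovers the sum
      -- along that contour.
      refine Eq.trans ?_ (hg (fun y => if y.1 ∈ l then 1 else 0) fun y => by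
        have : (next' y).1 = P.next y := rfl
        simp only [this, P.next_mem hl])
      refine Finset.sum_congr rfl fun y _ => ?_
      have hy := hc' y
      simp only [c'] at hy
      rw [hy]
      split_ifs <;> simp
    obtain ⟨f, p, h₁, h₂, h₃, h₄⟩ := P.potential c' (fun y hy => by
      by_cases hyK : y ∈ K
      · have := hc ⟨y, hyK⟩
        rw [← hc', ← hc'] at this
        exact this
      · have : P.rev y ∉ K := fun h => hyK (by
          have := IsLive.rev (hK.1 h)
          rw [P.rev_rev y hy] at this
          exact hK.2 this)
        simp [c', this, hyK]) (hsum _ hno) fun l hl => hsum l (List.mem_cons_of_mem _ hl)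
    have hpath : ∀ l ∈ P.outer :: P.cells, ∃ q, IsDartPath f (f ∘ P.rev) q l q := by
      intro l hl
      rcases List.mem_cons.1 hl with rfl | hl
      exacts [⟨p, h₁⟩, h₂ l hl]
    have hp : f root = p := by
      have : ∀ (l : List P.D) (h : l ≠ []), IsDartPath f (f ∘ P.rev) p l p → f (l.head h) = p := by
        intro l h hl
        cases l with
        | nil => exact absurd rfl h
        | cons x l => exact hl.1
      exact this _ ho h₁
    refine ⟨fun y => f y, fun y => ?_, fun y => ?_, fun hc1 y => ?_⟩
    · obtain ⟨l, hl, hyl⟩ := List.mem_flatten.1 (hK.1 y.2).mem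
      obtain ⟨q, hq⟩ := hpath l hl
      have := hq.source_formPerm (P.nodup_of_mem hl) hyl
      rw [← P.next_apply hl hyl] at this
      exact this
    · rw [← hc']
      exact h₃ y (hK.1 y.2).mem
    · change f y ≤ f root + h
      rw [hp]
      refine h₄ (fun z _ => ?_) y (hK.1 y.2).mem
      by_cases hz : z ∈ K
      · simpa [c', hz] using hc1 ⟨z, hz⟩
      · simp [c', hz]

end PlanarFilling

/-! ## From planar fillings to van Kampen diagrams -/

theorem Equiv.Perm.SameCycle.map_eq {D α : Type*} {σ : Equiv.Perm D} {g : D → α}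
    (hg : ∀ a, g (σ a) = g a) {a b : D} (h : σ.SameCycle a b) : g a = g b := by
  have hpow : ∀ (n : ℕ) a, g ((σ ^ n) a) = g a := by
    intro n
    induction n with
    | zero => simp
    | succ n ih => intro a; rw [pow_succ, Equiv.Perm.mul_apply, ih, hg]
  obtain ⟨n | n, rfl⟩ := h
  · simp [hpow]
  · have := hpow (n + 1) ((σ ^ Int.negSucc n) a)
    rw [zpow_negSucc, ← Equiv.Perm.mul_apply, mul_inv_cancel, Equiv.Perm.one_apply] at this
    rw [zpow_negSucc, this]

/-! ### Euler's formula from vanishing first cohomology. -/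

section Coboundary

variable {D : Type*} [Fintype D] {rev next : Equiv.Perm D}

/-- Summation by parts around the faces: reindexing by `next` makes the two halves of the sum equal.
-/
theorem sum_face_mul_vertex_coboundary {f g : D → ℝ} (hf : ∀ a, f (next a) = f (rev a))
    (hg : ∀ a, g (next a) = g a) : ∑ a, g a * (f (rev a) - f a) = 0 := by
  simp only [mul_sub, Finset.sum_sub_distrib]
  rw [sub_eq_zero, ← Equiv.sum_comp next fun a => g a * f a]
  exact Finset.sum_congr rfl fun a _ => by rw [hf, hg]

/-- Both halves reduce to the preceding identity, one of them after reindexing by `rev`. By this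
orthogonality a vertex coboundary and a face coboundary can cancel only if both vanish. -/
theorem sum_coboundary_mul_coboundary (hrev : ∀ a, rev (rev a) = a) {f g : D → ℝ}
    (hf : ∀ a, f (next a) = f (rev a)) (hg : ∀ a, g (next a) = g a) :
    ∑ a, (g a - g (rev a)) * (f (rev a) - f a) = 0 := by
  simp only [sub_mul, Finset.sum_sub_distrib]
  rw [sum_face_mul_vertex_coboundary hf hg, zero_sub, neg_eq_zero, ← neg_eq_zero,
    ← Finset.sum_neg_distrib, ← Equiv.sum_comp rev,
    ← sum_face_mul_vertex_coboundary hf hg]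
  exact Finset.sum_congr rfl fun a _ => by rw [hrev]; ring

/-- Euler's formula for a connected map in which antisymmetric functions on darts with vanishing
sums along faces are coboundaries. -/
theorem euler_of_potential [Nonempty D] {V F : Type*} [Fintype V] [Fintype F] {src : D → V}
    {face : D → F} (hsrc : Function.Surjective src) (hface : Function.Surjective face)
    (src_eq_iff : ∀ a b, src a = src b ↔ (next * rev).SameCycle a b)
    (face_eq_iff : ∀ a b, face a = face b ↔ next.SameCycle a b)
    (hrev : ∀ a, rev (rev a) = a) (hne : ∀ a, rev a ≠ a)
    (conn : ∀ f : D → ℝ, (∀ a, f (rev a) = f a) → (∀ a, f (next a) = f a) → ∀ a b, f a = f b)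
    (potential : ∀ c : D → ℝ, (∀ y, c (rev y) = -c y) →
      (∀ g : D → ℝ, (∀ y, g (next y) = g y) → ∑ y, g y * c y = 0) →
      ∃ f : D → ℝ, (∀ y, f (next y) = f (rev y)) ∧ ∀ y, f (rev y) = f y + c y) :
    2 * (Fintype.card V + Fintype.card F) = Fintype.card D + 4 := by
  classical
  have hsn : ∀ a, src (next a) = src (rev a) := fun a => (src_eq_iff _ _).2
    ((Equiv.Perm.sameCycle_apply_left.2 (Equiv.Perm.SameCycle.refl (next * rev) (rev a))).trans
      (Equiv.Perm.SameCycle.refl _ _) |> fun h => by simpa [hrev] using h)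
  have hfn : ∀ a, face (next a) = face a := fun a => (face_eq_iff _ _).2
    (Equiv.Perm.sameCycle_apply_left.2 (Equiv.Perm.SameCycle.refl _ _))
  let e := Fintype.equivFin D
  -- One dart of each edge, selected by an arbitrary numbering.
  let O : Type _ := {a : D // e a < e (rev a)}
  have hO : ∀ a, ¬ e a < e (rev a) ↔ e (rev a) < e (rev (rev a)) := fun a => by
    have : e (rev a) ≠ e a := fun h => hne a (e.injective h)
    rw [hrev, not_lt]
    exact ⟨fun h => lt_of_le_of_ne h this, le_of_lt⟩
  have hcard : Fintype.card D = 2 * Fintype.card O := by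
    have := Fintype.card_congr (Equiv.sumCompl fun a => e a < e (rev a))
    rw [Fintype.card_sum, Fintype.card_congr (Equiv.subtypeEquiv (p := fun a => ¬ e a < e (rev a))
        (q := fun a => e a < e (rev a)) rev hO)] at this
    rw [two_mul]
    exact this.symm
  -- `T` adds a vertex coboundary and a face coboundary. It is shown to be surjective with kernel
  -- the pairs of constants, so that `|V| + |F| = |E| + 2`.
  let T : ((V → ℝ) × (F → ℝ)) →ₗ[ℝ] (O → ℝ) :=
    { toFun := fun x a => (x.1 (src (rev a.1)) - x.1 (src a.1)) +
        (x.2 (face a.1) - x.2 (face (rev a.1)))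
      map_add' := fun x y => by ext a; simp only [Prod.fst_add, Prod.snd_add, Pi.add_apply]; ring
      map_smul' := fun r x => by
        ext a
        simp only [Prod.smul_fst, Prod.smul_snd, Pi.smul_apply, smul_eq_mul, RingHom.id_apply]
        ring }
  have hT : ∀ f g (a : O), T (f, g) a = (f (src (rev a.1)) - f (src a.1)) +
    (g (face a.1) - g (face (rev a.1))) := fun _ _ _ => rfl
  let ι : (ℝ × ℝ) →ₗ[ℝ] ((V → ℝ) × (F → ℝ)) :=
    { toFun := fun x => (fun _ => x.1, fun _ => x.2)
      map_add' := fun _ _ => rfl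
      map_smul' := fun _ _ => rfl }
  obtain ⟨a₀⟩ := ‹Nonempty D›
  have hι : Function.Injective ι := fun x y hxy => by
    have h₁ := congrFun (congrArg Prod.fst hxy) (src a₀)
    have h₂ := congrFun (congrArg Prod.snd hxy) (face a₀)
    exact Prod.ext h₁ h₂
  have hker : LinearMap.ker T = LinearMap.range ι := by
    ext ⟨f, g⟩
    constructor
    · intro hfg
      have h₁ : ∀ a, (f (src (rev a)) - f (src a)) = - (g (face a) - g (face (rev a))) := by
        intro a
        by_cases ha : e a < e (rev a)
        · have := congrFun (LinearMap.mem_ker.1 hfg) ⟨a, ha⟩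
          rw [hT, Pi.zero_apply] at this
          linarith
        · have := congrFun (LinearMap.mem_ker.1 hfg) ⟨rev a, (hO a).1 ha⟩
          rw [hT, Pi.zero_apply] at this
          simp only [hrev] at this
          linarith
      have h₂ := sum_coboundary_mul_coboundary (next := next) hrev (f := f ∘ src) (g := g ∘ face)
        (fun a => congrArg f (hsn a)) (fun a => congrArg g (hfn a))
      -- By `h₁` the two coboundaries are opposite, so their orthogonality says that a sum of
      -- squares vanishes.
      simp only [Function.comp_apply, h₁, mul_neg, Finset.sum_neg_distrib, neg_eq_zero] at h₂
      rw [Finset.sum_eq_zero_iff_of_nonneg fun _ _ => mul_self_nonneg _] at h₂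
      have h₃ : ∀ a, g (face (rev a)) = g (face a) := fun a => by
        have := mul_self_eq_zero.1 (h₂ a (Finset.mem_univ _))
        linarith
      have h₄ : ∀ a, f (src (rev a)) = f (src a) := fun a => by
        have := h₁ a
        rw [h₃] at this
        linarith
      refine ⟨(f (src a₀), g (face a₀)), ?_⟩
      refine Prod.ext (funext fun v => ?_) (funext fun k => ?_)
      · obtain ⟨a, rfl⟩ := hsrc v
        exact conn (f ∘ src) h₄ (fun a => (congrArg f (hsn a)).trans (h₄ a)) _ _
      · obtain ⟨a, rfl⟩ := hface k
        exact conn (g ∘ face) h₃ (fun a => congrArg g (hfn a)) _ _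
    · rintro ⟨⟨x, y⟩, hxy⟩
      rw [LinearMap.mem_ker, ← hxy]
      ext a
      simp [T, ι]
  have hrange : LinearMap.range T = ⊤ := by
    -- A functional killing the range has coefficients `k`, extended antisymmetrically to `c`.
    -- Killing face coboundaries, it makes `c` sum to zero along faces, so `c` is a vertex
    -- coboundary. As it kills that one as well, the squares of `k` sum to zero.
    by_contra hlt
    obtain ⟨φ, hφ, hle⟩ := Submodule.exists_le_ker_of_lt_top _ (lt_top_iff_ne_top.2 hlt)
    have hφs : ∀ x : O → ℝ, φ x = ∑ a, x a * φ (Pi.single a 1) := fun x => by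
      conv_lhs => rw [pi_eq_sum_univ' x, map_sum]
      refine Finset.sum_congr rfl fun a _ => ?_
      rw [map_smul, smul_eq_mul]
    let k : O → ℝ := fun a => φ (Pi.single a 1)
    let c : D → ℝ := fun a => if h : e a < e (rev a) then k ⟨a, h⟩ else
      -k ⟨rev a, (hO a).1 h⟩
    have hcO : ∀ a : O, c a.1 = k a := fun a => dif_pos a.2
    have hcrev : ∀ a, c (rev a) = -c a := by
      intro a
      by_cases ha : e a < e (rev a)
      · have h' : ¬ e (rev a) < e (rev (rev a)) := by rw [hrev]; exact ha.not_gt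
        simp only [c, dif_pos ha, dif_neg h', hrev]
      · have h' := (hO a).1 ha
        simp only [c, dif_neg ha, dif_pos h', neg_neg]
    have hsumO : ∀ g : D → ℝ, ∑ a, g a * c a = ∑ a : O, (g a.1 - g (rev a.1)) * k a := by
      intro g
      rw [← Equiv.sum_comp (Equiv.sumCompl fun a => e a < e (rev a)), Fintype.sum_sum_type,
        ← Equiv.sum_comp (Equiv.subtypeEquiv (p := fun a => e a < e (rev a))
          (q := fun a => ¬ e a < e (rev a)) rev fun a => by rw [hO, hrev]),
        ← Finset.sum_add_distrib]
      refine Finset.sum_congr rfl fun a _ => ?_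
      simp only [Equiv.sumCompl_apply_inl, Equiv.sumCompl_apply_inr, Equiv.subtypeEquiv_apply,
        hcrev]
      rw [hcO a]
      ring
    obtain ⟨f, hf₁, hf₂⟩ := potential c hcrev fun g hg => by
      obtain ⟨g', rfl⟩ : ∃ g' : F → ℝ, g = g' ∘ face := by
        refine ⟨fun x => g (Function.surjInv hface x), funext fun a => ?_⟩
        exact Equiv.Perm.SameCycle.map_eq hg
          ((face_eq_iff _ _).1 (Function.surjInv_eq hface (face a)).symm)
      have h₀ : φ (T (0, g')) = 0 := hle ⟨_, rfl⟩
      rw [hsumO, ← h₀, hφs]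
      exact Finset.sum_congr rfl fun a _ => by simp [hT, k]
    obtain ⟨f', rfl⟩ : ∃ f' : V → ℝ, f = f' ∘ src := by
      refine ⟨fun x => f (Function.surjInv hsrc x), funext fun a => ?_⟩
      refine Equiv.Perm.SameCycle.map_eq (σ := next * rev) (fun b => ?_)
        ((src_eq_iff _ _).1 (Function.surjInv_eq hsrc (src a)).symm)
      rw [Equiv.Perm.mul_apply, hf₁, hrev]
    have h₀ : φ (T (f', 0)) = 0 := hle ⟨_, rfl⟩
    rw [hφs] at h₀
    have h₁ : ∀ a : O, T (f', 0) a = k a := fun a => by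
      have := hf₂ a.1
      simp only [Function.comp_apply] at this
      rw [hT, this, ← hcO]
      simp
    simp only [h₁] at h₀
    rw [Finset.sum_eq_zero_iff_of_nonneg fun a _ => mul_self_nonneg (k a)] at h₀
    refine hφ (LinearMap.ext fun x => ?_)
    rw [hφs, LinearMap.zero_apply]
    refine Finset.sum_eq_zero fun a ha => ?_
    rw [show φ (Pi.single a 1) = 0 from mul_self_eq_zero.1 (h₀ a ha), mul_zero]
  have hdim := LinearMap.finrank_range_add_finrank_ker T
  rw [hrange, hker, LinearMap.finrank_range_of_inj hι, finrank_top, Module.finrank_prod,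
    Module.finrank_prod, Module.finrank_fintype_fun_eq_card, Module.finrank_fintype_fun_eq_card,
    Module.finrank_fintype_fun_eq_card, Module.finrank_self] at hdim
  omega

end Coboundary

/-! ### Connected planar maps as van Kampen diagrams. -/

namespace PermFilling

variable {X : Type*} {R : Set (FreeGroup X)} {w : List (X × Bool)} {A h : ℕ}

attribute [instance] PermFilling.fintype

/-- The vertices of a planar map. -/
abbrev V (Q : PermFilling R w A h) : Type := Quotient (Equiv.Perm.SameCycle.setoid (Q.next * Q.rev))

/-- The faces of a planar map. -/
abbrev F (Q : PermFilling R w A h) : Type := Quotient (Equiv.Perm.SameCycle.setoid Q.next)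

variable (Q : PermFilling R w A h)

/-- The initial vertex of a dart. -/
def src (a : Q.D) : Q.V := Quotient.mk _ a

/-- The face on the left of a dart. -/
def face (a : Q.D) : Q.F := Quotient.mk _ a

theorem src_eq_iff (a b : Q.D) : Q.src a = Q.src b ↔ (Q.next * Q.rev).SameCycle a b := Quotient.eq

theorem face_eq_iff (a b : Q.D) : Q.face a = Q.face b ↔ Q.next.SameCycle a b := Quotient.eq

theorem src_next (a : Q.D) : Q.src (Q.next a) = Q.src (Q.rev a) := by
  refine (Q.src_eq_iff _ _).2 ?_
  have := Equiv.Perm.sameCycle_apply_left.2 (Equiv.Perm.SameCycle.refl (Q.next * Q.rev) (Q.rev a))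
  rwa [Equiv.Perm.mul_apply, Q.rev_rev] at this

/-- The underlying graph of a planar map. -/
def graph : SimpleGraph Q.V :=
  SimpleGraph.fromRel fun u v => ∃ a, Q.src a = u ∧ Q.src (Q.rev a) = v

theorem eq_or_adj (a : Q.D) :
    Q.src a = Q.src (Q.rev a) ∨ Q.graph.Adj (Q.src a) (Q.src (Q.rev a)) := by
  refine or_iff_not_imp_left.2 fun h => ?_
  exact (SimpleGraph.fromRel_adj _ _ _).2 ⟨h, Or.inl ⟨a, rfl, rfl⟩⟩

theorem connected : Q.graph.Connected := by
  have key : ∀ a, Q.graph.Reachable (Q.src Q.root) (Q.src a) := by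
    refine Q.conn {a | Q.graph.Reachable (Q.src Q.root) (Q.src a)} ?_ ?_ ?_
    · exact SimpleGraph.Reachable.refl _
    · intro a ha
      simp only [Set.mem_ofPred_eq] at ha ⊢
      rcases Q.eq_or_adj a with h | h
      exacts [h ▸ ha, SimpleGraph.Reachable.trans ha h.reachable]
    · intro a ha
      simp only [Set.mem_ofPred_eq, Q.src_next] at ha ⊢
      rcases Q.eq_or_adj a with h | h
      exacts [h ▸ ha, SimpleGraph.Reachable.trans ha h.reachable]
  rw [SimpleGraph.connected_iff_exists_forall_reachable]
  refine ⟨Q.src Q.root, fun v => ?_⟩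
  induction v using Quotient.inductionOn with
  | h a => exact key a

theorem conn_eq (f : Q.D → ℝ) (h₁ : ∀ a, f (Q.rev a) = f a) (h₂ : ∀ a, f (Q.next a) = f a)
    (a b : Q.D) : f a = f b := by
  have : ∀ a, f a = f Q.root := Q.conn {a | f a = f Q.root} rfl
    (fun a ha => (h₁ a).trans ha) (fun a ha => (h₂ a).trans ha)
  rw [this a, this b]

/-- The `potential` property is applied to the coboundary of the distance `δ` from the root, which
changes by at most one along a dart. By connectedness the resulting potential differs from `δ` by a
constant. -/
theorem dist_le (a : Q.D) : Q.graph.dist (Q.src Q.root) (Q.src a) ≤ h := by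
  let δ : Q.D → ℝ := fun a => Q.graph.dist (Q.src Q.root) (Q.src a)
  have hδ : ∀ a, δ (Q.next a) = δ (Q.rev a) := fun a => by simp only [δ, Q.src_next]
  obtain ⟨f, hf₁, hf₂, hf₃⟩ := Q.potential (fun a => δ (Q.rev a) - δ a)
    (fun a => by rw [Q.rev_rev]; ring)
    (fun g hg => sum_face_mul_vertex_coboundary hδ hg)
  have hle := hf₃ (fun a => by
    have h₁ : Q.graph.dist (Q.src Q.root) (Q.src (Q.rev a)) ≤
        Q.graph.dist (Q.src Q.root) (Q.src a) + 1 := by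
      rcases Q.eq_or_adj a with h | h
      · rw [← h]; exact Nat.le_succ _
      · refine Q.connected.dist_triangle.trans (Nat.add_le_add_left ?_ _)
        exact (SimpleGraph.dist_eq_one_iff_adj.2 h).le
    have h₂ : δ (Q.rev a) ≤ δ a + 1 := by
      simp only [δ]
      exact_mod_cast h₁
    linarith) a
  have hc := Q.conn_eq (fun a => f a - δ a) (fun a => by rw [hf₂]; ring)
    (fun a => by rw [hf₁, hδ, hf₂]; ring) a Q.root
  have h₀ : δ Q.root = 0 := by simp [δ]
  have : δ a ≤ h := by simp only [h₀] at hc; linarith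
  simp only [δ] at this
  exact_mod_cast this

open Classical in
/-- The van Kampen diagram of a planar map. -/
noncomputable def toDiagram : VanKampenDiagram R w where
  V := Q.V
  D := Q.D
  F := Q.F
  rev := Q.rev
  rev_rev := Q.rev_rev
  rev_ne := Q.rev_ne
  next := Q.next
  src := Q.src
  face := Q.face
  src_eq_iff := Q.src_eq_iff
  face_eq_iff := Q.face_eq_iff
  connected := Q.connected
  euler := by
    have : Nonempty Q.D := ⟨Q.root⟩
    exact euler_of_potential Quotient.mk_surjective Quotient.mk_surjective Q.src_eq_iff
      Q.face_eq_iff Q.rev_rev Q.rev_ne Q.conn_eq fun c h₁ h₂ => by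
        obtain ⟨f, hf₁, hf₂, -⟩ := Q.potential c h₁ h₂
        exact ⟨f, hf₁, hf₂⟩
  label := Q.label
  label_rev := Q.label_rev
  outer := Q.face Q.root
  cell_label := fun k hk => by
    obtain ⟨y, rfl⟩ := Quotient.mk_surjective k
    rcases Q.cover y with hy | ⟨a, ha, hay⟩
    · exact absurd ((Q.face_eq_iff _ _).2 hy).symm hk
    · exact ⟨a, (Q.face_eq_iff _ _).2 hay, _, rfl, (Q.cell_label a ha).2⟩
  boundary_label := Or.inr ⟨Q.root, rfl, Q.root_label.symm⟩

theorem area_toDiagram : Q.toDiagram.area ≤ A := by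
  have key : ∀ k : {k : Q.F // k ≠ Q.face Q.root}, ∃ a : Q.cellRoots, Q.face a = k.1 := by
    rintro ⟨k, hk⟩
    obtain ⟨y, rfl⟩ := Quotient.mk_surjective k
    rcases Q.cover y with hy | ⟨a, ha, hay⟩
    · exact absurd ((Q.face_eq_iff _ _).2 hy).symm hk
    · exact ⟨⟨a, ha⟩, (Q.face_eq_iff _ _).2 hay⟩
  choose r hr using key
  have hinj : Function.Injective r := fun k l hkl => Subtype.ext (by rw [← hr, ← hr, hkl])
  refine (Nat.card_le_card_of_injective r hinj).trans ?_
  simpa using Q.card_cellRoots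

theorem diameter_toDiagram : Q.toDiagram.diameter ≤ (2 * h : ℕ) := by
  have key : ∀ v : Q.V, Q.graph.edist (Q.src Q.root) v ≤ h := by
    intro v
    induction v using Quotient.inductionOn with
    | h a =>
      rw [← (Q.connected _ _).coe_dist_eq_edist]
      exact_mod_cast Q.dist_le a
  refine SimpleGraph.ediam_le_iff.2 fun u v => ?_
  refine (SimpleGraph.edist_triangle (v := Q.src Q.root)).trans ?_
  rw [two_mul, Nat.cast_add]
  exact add_le_add (SimpleGraph.edist_comm (G := Q.graph) ▸ key u) (key v)

end PermFilling

/-- The diagram consisting of one point. -/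
def VanKampenDiagram.point {X : Type*} (R : Set (FreeGroup X)) : VanKampenDiagram R [] where
  V := Unit
  D := Empty
  F := Unit
  rev := 1
  rev_rev := by simp
  rev_ne := by simp
  next := 1
  src := Empty.elim
  face := Empty.elim
  src_eq_iff := by simp
  face_eq_iff := by simp
  connected := by
    rw [SimpleGraph.connected_iff_exists_forall_reachable]
    exact ⟨(), fun _ => SimpleGraph.Reachable.refl _⟩
  euler := by simp
  label := Empty.elim
  label_rev := by simp
  outer := ()
  cell_label := by simp
  boundary_label := Or.inl ⟨inferInstance, rfl⟩

/-- **van Kampen's lemma**, with a bound on area and diameter. -/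
theorem exists_diagram_of_isConjProd {X : Type*} [DecidableEq X] {R : Set (FreeGroup X)}
    {w : List (X × Bool)} {A h M : ℕ} (hR : ∀ r ∈ R, r.norm ≤ M)
    (H : IsConjProd R h A (FreeGroup.mk w)) :
    ∃ Δ : VanKampenDiagram R w, Δ.area ≤ A ∧ Δ.diameter ≤ (2 * max (h + M) w.length : ℕ) := by
  -- The empty contour has no dart to serve as `root`, so it is filled by a point.
  rcases eq_or_ne w [] with rfl | hw
  · refine ⟨VanKampenDiagram.point R, ?_, ?_⟩
    · have : IsEmpty {f : (VanKampenDiagram.point R).F // f ≠ (VanKampenDiagram.point R).outer} :=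
        ⟨fun f => f.2 rfl⟩
      simp [VanKampenDiagram.area]
    · refine SimpleGraph.ediam_le_iff.2 fun u v => ?_
      obtain rfl : u = v := Subsingleton.elim (α := Unit) u v
      simp
  · obtain ⟨P⟩ := PlanarFilling.exists_of_isConjProd hR H
    obtain ⟨Q⟩ := P.exists_permFilling hw
    exact ⟨Q.toDiagram, Q.area_toDiagram, Q.diameter_toDiagram⟩

/-! ## Subdividing loops by means of simply connected asymptotic cones -/

section Cone

open scoped unitInterval

variable {M : Type*} [PseudoMetricSpace M] {ω : Ultrafilter ℕ} {d : ScalingConstants} {o : ℕ → M}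

/-- The point of the asymptotic cone represented by a bounded sequence. -/
noncomputable def AsymptoticCone.mk (x : BoundedSeq M ω d o) : AsymptoticCone M ω d o := SeparationQuotient.mk x

theorem AsymptoticCone.mk_surjective :
    Function.Surjective (AsymptoticCone.mk : BoundedSeq M ω d o → AsymptoticCone M ω d o) :=
  SeparationQuotient.surjective_mk

theorem AsymptoticCone.dist_mk (x y : BoundedSeq M ω d o) :
    dist (AsymptoticCone.mk x) (AsymptoticCone.mk y) = x.limDist y := rfl

/-- The point `i / k` of the unit interval. -/
noncomputable def gridPoint (k i : ℕ) : I := Set.projIcc 0 1 zero_le_one (i / k : ℝ)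

theorem gridPoint_zero (k : ℕ) : gridPoint k 0 = 0 := by
  simp [gridPoint, Set.projIcc_left, unitInterval]

theorem gridPoint_self {k : ℕ} (hk : 1 ≤ k) : gridPoint k k = 1 := by
  have : (k : ℝ) ≠ 0 := by positivity
  rw [gridPoint, div_self this]
  exact Set.projIcc_right (zero_le_one (α := ℝ))

theorem coe_gridPoint {k i : ℕ} (hi : i ≤ k) : (gridPoint k i : ℝ) = i / k := by
  have h : (i / k : ℝ) ∈ Set.Icc (0 : ℝ) 1 :=
    ⟨by positivity, div_le_one_of_le₀ (by exact_mod_cast hi) (by positivity)⟩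
  exact congrArg Subtype.val (Set.projIcc_of_mem zero_le_one h)

theorem dist_gridPoint_succ_le (k i : ℕ) : dist (gridPoint k i) (gridPoint k (i + 1)) ≤ 1 / k := by
  have h : LipschitzWith 1 (Set.projIcc (0 : ℝ) 1 zero_le_one) := LipschitzWith.projIcc _
  refine (h.dist_le_mul _ _).trans ?_
  rw [Real.dist_eq, NNReal.coe_one, one_mul, ← sub_div, abs_div]
  simp

/-- If an asymptotic cone is simply connected, then a sequence of loops of length comparable with
the scaling constants bounds square grids with small meshes. -/
theorem exists_grid_of_simplyConnectedSpace (hω : (ω : Filter ℕ) ≤ cofinite)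
    [SimplyConnectedSpace (AsymptoticCone M ω d o)] (γ : ℕ → I → M) {C : ℝ} (hC : 0 ≤ C)
    (hγ : ∀ i s t, dist (γ i s) (γ i t) ≤ C * |(s : ℝ) - t| * d.val i + C)
    (h₀ : ∀ i, γ i 0 = o i) (h₁ : ∀ i, γ i 1 = o i) {ε : ℝ} (hε : 0 < ε) :
    ∃ k₀, ∀ k ≥ k₀, 1 ≤ k → ∀ᶠ i in (ω : Filter ℕ), ∃ g : ℕ → ℕ → M,
      (∀ a ≤ k, g a 0 = γ i (gridPoint k a)) ∧ (∀ a ≤ k, g a k = o i) ∧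
      (∀ b ≤ k, g 0 b = o i ∧ g k b = o i) ∧
      ∀ a ≤ k, ∀ b ≤ k, (b + 1 ≤ k → dist (g a b) (g a (b + 1)) ≤ ε * d.val i) ∧
        (a + 1 ≤ k → dist (g a b) (g (a + 1) b) ≤ ε * d.val i) := by
  have hd : Tendsto d.val (ω : Filter ℕ) atTop :=
    d.tendsto.mono_left (hω.trans Nat.cofinite_eq_atTop.le)
  have hdiv : Tendsto (fun i => C / d.val i) (ω : Filter ℕ) (𝓝 0) := hd.const_div_atTop C
  let Γ : I → BoundedSeq M ω d o := fun t => ⟨fun i => γ i t, C + C, by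
    filter_upwards [hd.eventually_ge_atTop 1] with i hi
    rw [← h₀, div_le_iff₀ (d.pos i)]
    refine (hγ i t 0).trans ?_
    have h₂ : |(t : ℝ) - (0 : I)| ≤ 1 := by
      simpa [abs_of_nonneg t.2.1] using t.2.2
    have h₃ : C * |(t : ℝ) - (0 : I)| * d.val i ≤ C * 1 * d.val i := by
      have := (d.pos i).le
      gcongr
    nlinarith⟩
  let O : BoundedSeq M ω d o := ⟨o, 0, by simp⟩
  have hO₀ : Γ 0 = O := Subtype.ext (funext h₀)
  have hO₁ : Γ 1 = O := Subtype.ext (funext h₁)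
  -- The additive error `C` disappears after division by `d i`, so the limit loop is Lipschitz.
  have hΓ : Continuous fun t => AsymptoticCone.mk (Γ t) := by
    refine (LipschitzWith.of_dist_le_mul (K := ⟨C, hC⟩) fun s t => ?_).continuous
    rw [AsymptoticCone.dist_mk]
    have hlim : Tendsto (fun i => C * dist s t + C / d.val i) (ω : Filter ℕ)
        (𝓝 (C * dist s t + 0)) := tendsto_const_nhds.add hdiv
    rw [add_zero] at hlim
    refine le_of_tendsto_of_tendsto' ((Γ s).tendsto_limDist (Γ t)) hlim fun i => ?_
    have hdi := d.pos i
    rw [div_le_iff₀ hdi, add_mul, div_mul_cancel₀ _ hdi.ne']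
    exact hγ i s t
  let p : Path (AsymptoticCone.mk O) (AsymptoticCone.mk O) :=
    ⟨⟨fun t => AsymptoticCone.mk (Γ t), hΓ⟩, by simp [hO₀], by simp [hO₁]⟩
  -- The first argument of `H` is the time of the homotopy, the second the parameter of the loop.
  obtain ⟨H⟩ := SimplyConnectedSpace.paths_homotopic p (Path.refl _)
  have hHu : UniformContinuous fun x : I × I => H x :=
    CompactSpace.uniformContinuous_of_continuous H.continuous
  obtain ⟨δ, hδ, hH⟩ := Metric.uniformContinuous_iff.1 hHu ε hε
  obtain ⟨k₀, hk₀⟩ := exists_nat_one_div_lt hδ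
  refine ⟨k₀ + 1, fun k hk hk1 => ?_⟩
  have hkδ : 1 / (k : ℝ) < δ := by
    refine lt_of_le_of_lt (one_div_le_one_div_of_le (by positivity) ?_) hk₀
    exact_mod_cast hk
  have hlift := Function.surjInv_eq (AsymptoticCone.mk_surjective (M := M) (ω := ω) (d := d)
    (o := o))
  -- On the boundary of the grid the lifts are prescribed exactly, by the loops and the base points;
  -- elsewhere any representative will do.
  let x : ℕ → ℕ → BoundedSeq M ω d o := fun a b =>
    if b = 0 then Γ (gridPoint k a) else if b = k ∨ a = 0 ∨ a = k then O else
      Function.surjInv AsymptoticCone.mk_surjective (H (gridPoint k b, gridPoint k a))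
  have hx : ∀ a b, AsymptoticCone.mk (x a b) = H (gridPoint k b, gridPoint k a) := by
    intro a b
    simp only [x]
    split_ifs with hb hab
    · rw [hb, gridPoint_zero, H.apply_zero]
      rfl
    · rcases hab with rfl | rfl | rfl
      · rw [gridPoint_self hk1, H.apply_one]
        rfl
      · rw [gridPoint_zero, H.source]
      · rw [gridPoint_self hk1, H.target]
    · exact hlift _
  have hnear : ∀ a b a' b', dist (gridPoint k a) (gridPoint k a') ≤ 1 / k →
      dist (gridPoint k b) (gridPoint k b') ≤ 1 / k →
      ∀ᶠ i in (ω : Filter ℕ), dist ((x a b).1 i) ((x a' b').1 i) ≤ ε * d.val i := by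
    intro a b a' b' ha hb
    have h₂ : (x a b).limDist (x a' b') < ε := by
      rw [← AsymptoticCone.dist_mk, hx, hx]
      exact hH (max_lt (hb.trans_lt hkδ) (ha.trans_lt hkδ))
    filter_upwards [((x a b).tendsto_limDist (x a' b')).eventually (gt_mem_nhds h₂)] with i hi
    exact ((div_lt_iff₀ (d.pos i)).1 hi).le
  -- Only finitely many pairs occur, so one `ω`-large set of indices serves them all. The index `k +
  -- 1` is harmless because `gridPoint` is clamped to the interval.
  have hall : ∀ᶠ i in (ω : Filter ℕ), ∀ a ∈ Set.Iic k, ∀ b ∈ Set.Iic k,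
      dist ((x a b).1 i) ((x a (b + 1)).1 i) ≤ ε * d.val i ∧
        dist ((x a b).1 i) ((x (a + 1) b).1 i) ≤ ε * d.val i := by
    refine ((Set.finite_Iic k).eventually_all).2 fun a _ =>
      ((Set.finite_Iic k).eventually_all).2 fun b _ => ?_
    exact (hnear a b a (b + 1) (by simp) (dist_gridPoint_succ_le k b)).and
      (hnear a b (a + 1) b (dist_gridPoint_succ_le k a) (by simp))
  filter_upwards [hall] with i hi
  have hk0 : k ≠ 0 := by omega
  refine ⟨fun a b => (x a b).1 i, fun a _ => by simp [x, Γ], fun a _ => by simp [x, hk0, O],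
    fun b _ => ?_, fun a ha b hb => ⟨fun _ => (hi a ha b hb).1, fun _ => (hi a ha b hb).2⟩⟩
  by_cases hb : b = 0
  · simp [x, hb, gridPoint_zero, gridPoint_self hk1, Γ, h₀, h₁]
  · simp [x, hb, O]

end Cone

/-! ### Grids spanned by trivial words in a group. -/

section Group

variable {G : Type*} [Group G] {S : Finset G} {X : Type*}

theorem exists_wordLength_map_mk_le [Finite X] (hS : Subgroup.closure (S : Set G) = ⊤)
    (φ : FreeGroup X →* G) :
    ∃ C : ℕ, ∀ w, wordLength S (φ (FreeGroup.mk w)) ≤ C * w.length := by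
  obtain ⟨C, hC⟩ := (Set.finite_range fun x => wordLength S (φ (FreeGroup.of x))).bddAbove
  have hC' : ∀ x, wordLength S (φ (FreeGroup.of x)) ≤ C := fun x => hC ⟨x, rfl⟩
  refine ⟨C, fun w => ?_⟩
  induction w with
  | nil =>
    rw [← FreeGroup.one_eq_mk, map_one, wordLength_one]
    exact Nat.zero_le _
  | cons x w ih =>
    have h₁ : wordLength S (φ (FreeGroup.mk [x])) ≤ C := by
      rcases x with ⟨x, _ | _⟩
      · have : FreeGroup.mk [(x, false)] = (FreeGroup.of x)⁻¹ := rfl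
        rw [this, map_inv]
        exact (wordLength_inv_le hS _).trans (hC' x)
      · exact hC' x
    rw [← List.singleton_append, ← FreeGroup.mul_mk, map_mul, List.length_append,
      List.length_singleton, mul_add, mul_one]
    exact (wordLength_mul_le hS _ _).trans (Nat.add_le_add h₁ ih)

theorem mk_take_inv_mul_mk_take {w : List (X × Bool)} {a b : ℕ} (hab : a ≤ b) :
    (FreeGroup.mk (w.take a))⁻¹ * FreeGroup.mk (w.take b) =
      FreeGroup.mk ((w.take b).drop a) := by
  have : w.take b = w.take a ++ (w.take b).drop a := by
    conv_lhs => rw [← List.take_append_drop a (w.take b), List.take_take, min_eq_left hab]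
  conv_lhs => rw [this, ← FreeGroup.mul_mk, inv_mul_cancel_left]

/-- An element of `G`, as a point of `WordMetric S hS`. -/
def WordMetric.of (hS : Subgroup.closure (S : Set G) = ⊤) (g : G) : WordMetric S hS := g

theorem WordMetric.dist_of (hS : Subgroup.closure (S : Set G) = ⊤) (g h : G) :
    dist (WordMetric.of hS g) (WordMetric.of hS h) = wordLength S (g⁻¹ * h) := rfl

theorem dist_map_mk_take_le (hS : Subgroup.closure (S : Set G) = ⊤) {φ : FreeGroup X →* G} {C : ℕ}
    (hC : ∀ w, wordLength S (φ (FreeGroup.mk w)) ≤ C * w.length) (w : List (X × Bool)) (a b : ℕ) :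
    dist (WordMetric.of hS (φ (FreeGroup.mk (w.take a))))
      (WordMetric.of hS (φ (FreeGroup.mk (w.take b)))) ≤
      C * |(a : ℝ) - b| := by
  wlog hab : a ≤ b generalizing a b
  · rw [dist_comm, abs_sub_comm]
    exact this b a (le_of_not_ge hab)
  have h₁ : wordLength S ((φ (FreeGroup.mk (w.take a)))⁻¹ * φ (FreeGroup.mk (w.take b))) ≤
      C * (b - a) := by
    rw [← map_inv, ← map_mul, mk_take_inv_mul_mk_take hab]
    refine (hC _).trans (Nat.mul_le_mul_left _ ?_)
    rw [List.length_drop, List.length_take]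
    omega
  have h₂ : |(a : ℝ) - b| = ((b - a : ℕ) : ℝ) := by
    rw [abs_sub_comm, Nat.cast_sub hab, abs_of_nonneg]
    have : (a : ℝ) ≤ b := by exact_mod_cast hab
    linarith
  rw [h₂, WordMetric.dist_of]
  exact_mod_cast h₁

/-- If all asymptotic cones are simply connected, then all long words that are trivial in the group
bound square grids of bounded size with meshes much shorter than the word. -/
theorem exists_grid [Finite X] {hS : Subgroup.closure (S : Set G) = ⊤}
    (hcones : AllConesSimplyConnected S hS) (φ : FreeGroup X →* G) (q : ℕ) :
    ∃ m N : ℕ, ∀ w : List (X × Bool), N ≤ w.length → φ (FreeGroup.mk w) = 1 →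
      ∃ k, q ≤ k ∧ 1 ≤ k ∧ k ≤ m ∧ ∃ g : ℕ → ℕ → G,
        (∀ a ≤ k, g a 0 = φ (FreeGroup.mk (w.take (a * w.length / k)))) ∧
        (∀ a ≤ k, g a k = 1) ∧ (∀ b ≤ k, g 0 b = 1 ∧ g k b = 1) ∧
        ∀ a ≤ k, ∀ b ≤ k,
          (b + 1 ≤ k → q * wordLength S ((g a b)⁻¹ * g a (b + 1)) ≤ w.length) ∧
          (a + 1 ≤ k → q * wordLength S ((g a b)⁻¹ * g (a + 1) b) ≤ w.length) := by
  by_contra! hcon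
  -- One counterexample for each `m`, with strictly increasing lengths `ψ m`; these lengths provide
  -- the scaling constants.
  obtain ⟨ψ, hψ, hw⟩ := Filter.extraction_forall_of_frequently
    (P := fun m n => ∃ w : List (X × Bool), w.length = n ∧ φ (FreeGroup.mk w) = 1 ∧
      ∀ k, q ≤ k → 1 ≤ k → k ≤ m → ¬ ∃ g : ℕ → ℕ → G,
        (∀ a ≤ k, g a 0 = φ (FreeGroup.mk (w.take (a * w.length / k)))) ∧
        (∀ a ≤ k, g a k = 1) ∧ (∀ b ≤ k, g 0 b = 1 ∧ g k b = 1) ∧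
        ∀ a ≤ k, ∀ b ≤ k,
          (b + 1 ≤ k → q * wordLength S ((g a b)⁻¹ * g a (b + 1)) ≤ w.length) ∧
          (a + 1 ≤ k → q * wordLength S ((g a b)⁻¹ * g (a + 1) b) ≤ w.length)) fun m =>
    Filter.frequently_atTop.2 fun N => by
      obtain ⟨w, hw₁, hw₂, hw₃⟩ := hcon m N
      refine ⟨w.length, hw₁, w, rfl, hw₂, fun k hk₁ hk₂ hk₃ => ?_⟩
      rintro ⟨g, hg₁, hg₂, hg₃, hg₄⟩
      obtain ⟨a, ha, b, hb, hab⟩ := hw₃ k hk₁ hk₂ hk₃ g hg₁ hg₂ hg₃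
      have := hg₄ a ha b hb
      by_cases h : b + 1 ≤ k ∧ w.length < q * wordLength S ((g a b)⁻¹ * g a (b + 1))
      · exact absurd (this.1 h.1) (not_le.2 h.2)
      · obtain ⟨h₁, h₂⟩ := hab fun h' => not_lt.1 fun h'' => h ⟨h', h''⟩
        exact absurd (this.2 h₁) (not_le.2 h₂)
  choose w hwl hw₁ hw₂ using hw
  obtain ⟨C, hC⟩ := exists_wordLength_map_mk_le hS φ
  have hcast : Tendsto (fun i => (ψ i : ℝ) + 1) atTop atTop :=
    tendsto_atTop_add_const_right _ _ (tendsto_natCast_atTop_atTop.comp hψ.tendsto_atTop)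
  -- One is added because `ψ 0` may be zero.
  let d : ScalingConstants :=
    { val := fun i => (ψ i : ℝ) + 1
      pos := fun i => by positivity
      mono := fun i j hij => by
        have := hψ.monotone hij
        simpa using this
      tendsto := hcast }
  have hω : ((hyperfilter ℕ : Ultrafilter ℕ) : Filter ℕ) ≤ cofinite := hyperfilter_le_cofinite
  have hsc := hcones (hyperfilter ℕ) hω d
  let γ : ℕ → unitInterval → WordMetric S hS := fun i t =>
    WordMetric.of hS (φ (FreeGroup.mk ((w i).take ⌊(t : ℝ) * ψ i⌋₊)))
  obtain ⟨k₀, hk₀⟩ := exists_grid_of_simplyConnectedSpace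
    (o := fun _ => WordMetric.basepoint S hS) hω γ (C := C) (Nat.cast_nonneg C)
    (fun i s t => by
      refine (dist_map_mk_take_le hS hC (w i) _ _).trans ?_
      have hψi : (0 : ℝ) ≤ ψ i := Nat.cast_nonneg _
      have h₁ := Nat.floor_le (mul_nonneg s.2.1 hψi)
      have h₂ := Nat.floor_le (mul_nonneg t.2.1 hψi)
      have h₃ := Nat.lt_floor_add_one ((s : ℝ) * ψ i)
      have h₄ := Nat.lt_floor_add_one ((t : ℝ) * ψ i)
      have h₅ : |(⌊(s : ℝ) * ψ i⌋₊ : ℝ) - ⌊(t : ℝ) * ψ i⌋₊| ≤ |(s : ℝ) - t| * ψ i + 1 := by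
        rw [← abs_of_nonneg hψi, ← abs_mul, abs_of_nonneg hψi, sub_mul]
        have h₆ := le_abs_self ((s : ℝ) * ψ i - t * ψ i)
        have h₇ := neg_le_abs ((s : ℝ) * ψ i - t * ψ i)
        rw [abs_le]
        constructor <;> linarith
      have h₈ : (0 : ℝ) ≤ C := Nat.cast_nonneg C
      calc (C : ℝ) * |(⌊(s : ℝ) * ψ i⌋₊ : ℝ) - ⌊(t : ℝ) * ψ i⌋₊|
          ≤ C * (|(s : ℝ) - t| * (ψ i + 1) + 1) := by
            refine mul_le_mul_of_nonneg_left (h₅.trans ?_) h₈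
            have := abs_nonneg ((s : ℝ) - t)
            linarith
        _ = C * |(s : ℝ) - t| * d.val i + C := by ring)
    (fun i => by
      simp only [γ]
      rw [show ((0 : unitInterval) : ℝ) = 0 from rfl, zero_mul, Nat.floor_zero, List.take_zero,
        ← FreeGroup.one_eq_mk, map_one]
      rfl)
    (fun i => by
      simp only [γ]
      rw [show ((1 : unitInterval) : ℝ) = 1 from rfl, one_mul, Nat.floor_natCast, ← hwl,
        List.take_length, hw₁]
      rfl)
    -- The factor 2 absorbs `ψ i + 1 ≤ 2 * ψ i`.
    (ε := 1 / (2 * (q + 1))) (by positivity)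
  set k := max k₀ (max q 1) with hk
  have hk1 : 1 ≤ k := (le_max_right _ _).trans (le_max_right _ _)
  have hkq : q ≤ k := (le_max_left _ _).trans (le_max_right _ _)
  -- The `i`-th word is only known to lack grids with at most `i` subdivisions, so `k ≤ i` is needed
  -- as well.
  have hev := (hk₀ k (le_max_left _ _) hk1).and
    ((hω.trans Nat.cofinite_eq_atTop.le) (eventually_ge_atTop k))
  obtain ⟨i, ⟨g, hg₁, hg₂, hg₃, hg₄⟩, hik⟩ := hev.exists
  have hψi : 1 ≤ ψ i := (hk1.trans hik).trans (hψ.id_le i)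
  have hle : ∀ l : ℕ, (l : ℝ) ≤ 1 / (2 * (q + 1)) * d.val i → q * l ≤ (w i).length := by
    intro l hl
    have h₁ : (1 : ℝ) ≤ ψ i := by exact_mod_cast hψi
    have h₂ : d.val i = ψ i + 1 := rfl
    rw [h₂, one_div, inv_mul_eq_div, le_div_iff₀ (by positivity)] at hl
    have h₃ : ((q * l : ℕ) : ℝ) ≤ ψ i := by
      push_cast
      have : (0 : ℝ) ≤ l := Nat.cast_nonneg l
      nlinarith
    rw [hwl]
    exact_mod_cast h₃
  refine hw₂ i k hkq hk1 hik ⟨g, fun a ha => ?_, hg₂, hg₃, fun a ha b hb =>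
    ⟨fun h => hle _ ((hg₄ a ha b hb).1 h), fun h => hle _ ((hg₄ a ha b hb).2 h)⟩⟩
  rw [hg₁ a ha]
  simp only [γ]
  rw [coe_gridPoint ha, hwl, div_mul_eq_mul_div, ← Nat.cast_mul, Nat.floor_div_eq_div]
  rfl

end Group

/-! ## Isoperimetric and isodiametric inequalities -/

section Group

variable {G : Type*} [Group G] {S : Finset G} {X : Type*} [DecidableEq X]

theorem norm_prod_range_map_le (h : ℕ → FreeGroup X) {L a : ℕ} (hL : ∀ i < a, (h i).norm ≤ L) :
    ((List.range a).map h).prod.norm ≤ a * L := by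
  induction a with
  | zero => simp
  | succ a ih =>
    rw [List.prod_range_succ, Nat.succ_mul]
    exact (FreeGroup.norm_mul_le _ _).trans
      (Nat.add_le_add (ih fun i hi => hL i (by omega)) (hL a (by omega)))

/-- The label of the boundary of a square grid is a product of conjugates of the labels of the
meshes, provided that three of the sides are trivial. -/
theorem isConjProd_of_grid {T : Set (FreeGroup X)} {k L : ℕ} (h v : ℕ → ℕ → FreeGroup X)
    (hL : ∀ a < k, ∀ b < k, (h a b).norm ≤ L)
    (hT : ∀ a < k, ∀ b < k, h a b * v (a + 1) b * (h a (b + 1))⁻¹ * (v a b)⁻¹ ∈ T)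
    (hv₀ : ∀ b < k, v 0 b = 1) (hv₁ : ∀ b < k, v k b = 1) (hh : ∀ a < k, h a k = 1) :
    IsConjProd T (k * L) (k * k) ((List.range k).map fun i => h i 0).prod := by
  let P : ℕ → ℕ → FreeGroup X := fun a b => ((List.range a).map fun i => h i b).prod
  have hP : ∀ a b, P (a + 1) b = P a b * h a b := fun a b => List.prod_range_succ _ _
  -- In the strip between rows `b` and `b + 1` each mesh contributes one conjugate, with conjugator
  -- the path `P a b` along row `b`.
  have hrow : ∀ b < k, ∀ a ≤ k, IsConjProd T (k * L) a (P a b * v a b * (P a (b + 1))⁻¹) := by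
    intro b hb a
    induction a with
    | zero =>
      intro _
      simpa [P, hv₀ b hb] using IsConjProd.one
    | succ a ih =>
      intro ha
      have hn : (P a b).norm ≤ k * L :=
        (norm_prod_range_map_le _ fun i hi => hL i (by omega) b hb).trans
          (Nat.mul_le_mul_right _ (by omega))
      have := IsConjProd.mul hn (Or.inl (hT a (by omega) b hb)) (ih (by omega))
      convert this using 1
      rw [hP, hP]
      group
  -- Because the side at `a = k` is trivial, the strips multiply up and leave only the row at `b =
  -- k`, which is trivial too.
  have hcol : ∀ b ≤ k, IsConjProd T (k * L) (b * k) (P k 0 * (P k b)⁻¹) := by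
    intro b
    induction b with
    | zero =>
      intro _
      simpa using IsConjProd.one
    | succ b ih =>
      intro hb
      have := (ih (by omega)).mul' (hrow b (by omega) k le_rfl)
      rw [hv₁ b (by omega)] at this
      rw [Nat.succ_mul]
      convert this using 1
      group
  have htop : P k k = 1 := by
    refine List.prod_eq_one fun x hx => ?_
    obtain ⟨i, hi, rfl⟩ := List.mem_map.1 hx
    exact hh i (List.mem_range.1 hi)
  simpa [htop] using hcol k le_rfl

/-- Shortest words are lifted letter by letter. The bound has no additive constant, so the lift of
`1` must be `1`, which keeps the trivial sides of a grid trivial. -/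
theorem exists_lift_norm_le (hS : Subgroup.closure (S : Set G) = ⊤) {φ : FreeGroup X →* G}
    (hφ : Function.Surjective φ) :
    ∃ C : ℕ, ∀ g, ∃ u, φ u = g ∧ u.norm ≤ C * wordLength S g := by
  let C := S.sup fun x => (Function.surjInv hφ x).norm
  refine ⟨C, fun g => ?_⟩
  obtain ⟨l, hl, rfl, hn⟩ := exists_word_of_closure hS g
  rw [← hn]
  clear hn
  induction l with
  | nil => exact ⟨1, by simp, by simp⟩
  | cons x l ih =>
    simp only [List.forall_mem_cons] at hl
    obtain ⟨u, hu, hun⟩ := ih hl.2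
    obtain ⟨t, ht, htn⟩ : ∃ t, φ t = x ∧ t.norm ≤ C := by
      rcases hl.1 with hx | hx
      · exact ⟨Function.surjInv hφ x, Function.surjInv_eq hφ x,
          Finset.le_sup (f := fun x => (Function.surjInv hφ x).norm) hx⟩
      · refine ⟨(Function.surjInv hφ x⁻¹)⁻¹, by rw [map_inv, Function.surjInv_eq hφ, inv_inv], ?_⟩
        rw [FreeGroup.norm_inv_eq]
        exact Finset.le_sup (f := fun x => (Function.surjInv hφ x).norm) hx
    refine ⟨t * u, by rw [map_mul, ht, hu, List.prod_cons], ?_⟩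
    rw [List.length_cons, mul_add, mul_one, add_comm]
    exact (FreeGroup.norm_mul_le _ _).trans (Nat.add_le_add htn hun)

/-- If all asymptotic cones are simply connected, then every long trivial word of length `n` is a
product of a bounded number of conjugates of trivial words of length at most `n / 2`. -/
theorem exists_isConjProd_half [Finite X] {hS : Subgroup.closure (S : Set G) = ⊤}
    (hcones : AllConesSimplyConnected S hS) {φ : FreeGroup X →* G} (hφ : Function.Surjective φ) :
    ∃ m N : ℕ, ∀ u, φ u = 1 → N ≤ u.norm →
      ∃ A ≤ m, IsConjProd {v | φ v = 1 ∧ v.norm ≤ u.norm / 2} (m * u.norm) A u := by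
  obtain ⟨C, hC⟩ := exists_lift_norm_le hS hφ
  choose s hs hsn using hC
  -- Lifted edges get length at most `n / 16`, bottom edges at most `n / 16 + 1`; the perimeter of a
  -- mesh is then at most `n / 4 + 1`, which is at most `n / 2` once `n ≥ 4`. Using `C + 1` ensures
  -- `k ≥ 16` even for `C = 0`.
  obtain ⟨m, N, hmN⟩ := exists_grid hcones φ (16 * (C + 1))
  refine ⟨m * m, max N 4, fun u hu hun => ?_⟩
  obtain ⟨k, hqk, hk1, hkm, g, hg₀, hgt, hgs, hg⟩ := hmN u.toWord (le_of_max_le_left hun)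
    (by rwa [FreeGroup.mk_toWord])
  have hn4 : 4 ≤ u.norm := le_of_max_le_right hun
  have hlen : u.toWord.length = u.norm := rfl
  rw [hlen] at hg₀ hg
  generalize u.norm = n at *
  have hs1 : s 1 = 1 := by
    have := hsn 1
    rw [wordLength_one, mul_zero, Nat.le_zero, FreeGroup.norm_eq_zero] at this
    exact this
  have hsq : ∀ x, 16 * (C + 1) * wordLength S x ≤ n → 16 * (s x).norm ≤ n := fun x hx => by
    have := hsn x
    nlinarith
  let t : ℕ → FreeGroup X := fun a => FreeGroup.mk (u.toWord.take (a * n / k))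
  let v : ℕ → ℕ → FreeGroup X := fun a b => s ((g a b)⁻¹ * g a (b + 1))
  -- The row `b = 0` keeps the actual subwords of `u`, so that its product telescopes to `u`.
  let h : ℕ → ℕ → FreeGroup X := fun a b =>
    if b = 0 then (t a)⁻¹ * t (a + 1) else s ((g a b)⁻¹ * g (a + 1) b)
  have hv : ∀ a ≤ k, ∀ b < k, 16 * (v a b).norm ≤ n := fun a ha b hb =>
    hsq _ ((hg a ha b hb.le).1 hb)
  have hh₁ : ∀ a < k, ∀ b ≤ k, b ≠ 0 → 16 * (h a b).norm ≤ n := fun a ha b hb hb0 => by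
    simp only [h, if_neg hb0]
    exact hsq _ ((hg a ha.le b hb).2 ha)
  have hh₀ : ∀ a < k, 16 * (h a 0).norm ≤ n + 16 := fun a ha => by
    simp only [h, if_true, t]
    have h₁ : (a + 1) * n / k ≤ a * n / k + n / k + 1 := by
      rw [add_mul, one_mul, Nat.add_div (by omega)]
      split_ifs <;> omega
    have h₂ : a * n / k ≤ (a + 1) * n / k := Nat.div_le_div_right (Nat.mul_le_mul_right _ (by omega))
    have h₃ : 16 * (n / k) ≤ n := by
      have h₄ : n / k ≤ n / 16 := Nat.div_le_div_left (by omega) (by omega)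
      omega
    rw [mk_take_inv_mul_mk_take h₂]
    have h₅ := FreeGroup.norm_mk_le (L₁ := (u.toWord.take ((a + 1) * n / k)).drop (a * n / k))
    rw [List.length_drop, List.length_take] at h₅
    omega
  have hh : ∀ a < k, ∀ b ≤ k, 16 * (h a b).norm ≤ n + 16 := fun a ha b hb => by
    by_cases hb0 : b = 0
    · rw [hb0]; exact hh₀ a ha
    · exact (hh₁ a ha b hb hb0).trans (Nat.le_add_right _ _)
  have hφh : ∀ a < k, ∀ b ≤ k, φ (h a b) = (g a b)⁻¹ * g (a + 1) b := fun a ha b hb => by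
    by_cases hb0 : b = 0
    · simp only [hb0, h, if_true, t, map_mul, map_inv]
      rw [hg₀ a ha.le, hg₀ (a + 1) ha]
    · simp only [h, if_neg hb0, hs]
  have key := isConjProd_of_grid (T := {v | φ v = 1 ∧ v.norm ≤ n / 2}) (k := k) (L := n) h v
    (fun a ha b hb => by have := hh a ha b hb.le; omega)
    (fun a ha b hb => by
      refine ⟨?_, ?_⟩
      · simp only [map_mul, map_inv]
        rw [hφh a ha b hb.le, hφh a ha (b + 1) hb, hs, hs]
        group
      · have h₁ := FreeGroup.norm_mul_le (h a b * v (a + 1) b * (h a (b + 1))⁻¹) (v a b)⁻¹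
        have h₂ := FreeGroup.norm_mul_le (h a b * v (a + 1) b) (h a (b + 1))⁻¹
        have h₃ := FreeGroup.norm_mul_le (h a b) (v (a + 1) b)
        rw [FreeGroup.norm_inv_eq] at h₁ h₂
        have h₄ := hh a ha b hb.le
        have h₅ := hv a ha.le b hb
        have h₆ := hv (a + 1) ha b hb
        have h₇ := hh₁ a ha (b + 1) hb (Nat.succ_ne_zero b)
        omega)
    (fun b hb => by simp only [v, (hgs b hb.le).1, (hgs (b + 1) hb).1, inv_one, mul_one, hs1])
    (fun b hb => by simp only [v, (hgs b hb.le).2, (hgs (b + 1) hb).2, inv_one, mul_one, hs1])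
    (fun a ha => by
      simp only [h, if_neg (by omega : k ≠ 0), hgt a ha.le, hgt (a + 1) ha, inv_one, mul_one, hs1])
  have htel : ∀ a, ((List.range a).map fun i => h i 0).prod = t a := by
    intro a
    induction a with
    | zero => simp [t, ← FreeGroup.one_eq_mk]
    | succ a ih =>
      rw [List.prod_range_succ, ih]
      simp [h]
  have htk : t k = u := by
    simp only [t]
    rw [Nat.mul_div_cancel_left _ (by omega : 0 < k), ← hlen, List.take_length,
      FreeGroup.mk_toWord]
  rw [htel, htk] at key
  exact ⟨k * k, Nat.mul_le_mul hkm hkm, key.mono_right (Nat.mul_le_mul_right _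
    (hkm.trans (Nat.le_mul_self m)))⟩

theorem finite_norm_le [Finite X] (N : ℕ) : {u : FreeGroup X | u.norm ≤ N}.Finite :=
  (List.finite_length_le (X × Bool) N).preimage FreeGroup.toWord_injective.injOn

/-- If long trivial words decompose into a bounded number of trivial words of half the length, then
a trivial word of length `n` is a product of polynomially many conjugates of relators, with conjugating
elements of linear length. -/
theorem exists_isConjProd_of_half {K : FreeGroup X → Prop} {R : Set (FreeGroup X)} {m N c : ℕ}
    (hhalf : ∀ u, K u → N ≤ u.norm →
      ∃ A ≤ m, IsConjProd {v | K v ∧ v.norm ≤ u.norm / 2} (m * u.norm) A u)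
    (hbase : ∀ u, K u → u.norm < N → ∃ A ≤ c, IsConjProd R c A u) (u : FreeGroup X) (hu : K u) :
    ∃ A ≤ c * u.norm ^ m, IsConjProd R (2 * m * u.norm + c) A u := by
  induction hn : u.norm using Nat.strong_induction_on generalizing u with
  | _ n ih =>
    rcases Nat.eq_zero_or_pos n with rfl | hpos
    · rw [FreeGroup.norm_eq_zero] at hn
      exact ⟨0, Nat.zero_le _, hn ▸ .one⟩
    rcases lt_or_ge n N with hnN | hnN
    · obtain ⟨A, hA, H⟩ := hbase u hu (hn ▸ hnN)
      refine ⟨A, hA.trans ?_, H.mono_right (Nat.le_add_left _ _)⟩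
      exact Nat.le_mul_of_pos_right _ (pow_pos hpos m)
    · obtain ⟨A, hA, H⟩ := hhalf u hu (hn ▸ hnN)
      rw [hn] at H
      obtain ⟨B, hB, H'⟩ := H.subst (U := R) (B := c * (n / 2) ^ m) (h' := 2 * m * (n / 2) + c)
        fun v hv => by
          obtain ⟨A', hA', H'⟩ := ih v.norm (by have := hv.2; omega) v hv.1 rfl
          refine ⟨A', hA'.trans ?_, H'.mono_right ?_⟩
          · exact Nat.mul_le_mul_left _ (Nat.pow_le_pow_left hv.2 m)
          · exact Nat.add_le_add_right (Nat.mul_le_mul_left _ hv.2) _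
      refine ⟨B, hB.trans ?_, H'.mono_right ?_⟩
      -- The crude bound `m ≤ 2 ^ m` lets the exponent `m` absorb the factor `m` of each halving.
      · calc A * (c * (n / 2) ^ m) ≤ 2 ^ m * (c * (n / 2) ^ m) :=
              Nat.mul_le_mul_right _ (hA.trans Nat.lt_two_pow_self.le)
          _ = c * (n / 2 * 2) ^ m := by rw [mul_pow]; ring
          _ ≤ c * n ^ m := Nat.mul_le_mul_left _ (Nat.pow_le_pow_left (Nat.div_mul_le_self n 2) m)
      -- Geometric series: `m * n + 2 * m * (n / 2) ≤ 2 * m * n`.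
      · have h₁ : n / 2 * 2 ≤ n := Nat.div_mul_le_self n 2
        nlinarith

/-- Halving ends at trivial words shorter than `N`, so the finitely many trivial words of length at
most `N` normally generate the kernel. -/
theorem isFinitelyPresented_of_cones {hS : Subgroup.closure (S : Set G) = ⊤}
    (hcones : AllConesSimplyConnected S hS) : Group.IsFinitelyPresented G := by
  let φ : FreeGroup (Fin S.card) →* G := FreeGroup.lift fun i => (S.equivFin.symm i : G)
  have hφ : Function.Surjective φ := by
    rw [← MonoidHom.range_eq_top, FreeGroup.range_lift_eq_closure, ← hS]
    congr 1
    ext x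
    refine ⟨?_, fun hx => ⟨S.equivFin ⟨x, hx⟩, by simp⟩⟩
    rintro ⟨i, rfl⟩
    exact (S.equivFin.symm i).2
  obtain ⟨m, N, hhalf⟩ := exists_isConjProd_half hcones hφ
  refine ⟨S.card, φ, hφ, {u | φ u = 1 ∧ u.norm ≤ N},
    (finite_norm_le N).subset fun u hu => hu.2, le_antisymm ?_ fun u hu => ?_⟩
  · exact Subgroup.normalClosure_le_normal fun u hu => hu.1
  · obtain ⟨A, -, H⟩ := exists_isConjProd_of_half (c := 1) (R := {u | φ u = 1 ∧ u.norm ≤ N}) hhalf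
      (fun u hu hun => ⟨1, le_rfl, .of_mem (Or.inl ⟨hu, hun.le⟩)⟩) u hu
    exact H.mem_normalClosure

/-- There are finitely many words of length at most `N`, so a single `c` bounds the cost of all
trivial words at which halving stops. -/
theorem exists_isConjProd_of_cones [Finite X] {hS : Subgroup.closure (S : Set G) = ⊤}
    (hcones : AllConesSimplyConnected S hS) {R : Set (FreeGroup X)} (e : PresentedGroup R ≃* G) :
    ∃ m c : ℕ, ∀ u ∈ Subgroup.normalClosure R,
      ∃ A ≤ c * u.norm ^ m, IsConjProd R (2 * m * u.norm + c) A u := by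
  let φ : FreeGroup X →* G := e.toMonoidHom.comp (PresentedGroup.mk R)
  have hφ : Function.Surjective φ := e.surjective.comp (PresentedGroup.mk_surjective R)
  have hker : ∀ u, φ u = 1 ↔ u ∈ Subgroup.normalClosure R := fun u => by
    simp only [φ, MonoidHom.comp_apply, MulEquiv.toMonoidHom_eq_coe, MonoidHom.coe_coe,
      map_eq_one_iff e e.injective]
    exact PresentedGroup.mk_eq_one_iff
  obtain ⟨m, N, hhalf⟩ := exists_isConjProd_half hcones hφ
  have hbase : ∀ u, ∃ c, φ u = 1 → ∃ A ≤ c, IsConjProd R c A u := fun u => by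
    by_cases hu : φ u = 1
    · obtain ⟨h, A, H⟩ := IsConjProd.exists_of_mem_normalClosure ((hker u).1 hu)
      exact ⟨max h A, fun _ => ⟨A, le_max_right _ _, H.mono_right (le_max_left _ _)⟩⟩
    · exact ⟨0, fun h => absurd h hu⟩
  choose c₀ hc₀ using hbase
  obtain ⟨c, hc⟩ := ((finite_norm_le (X := X) N).image c₀).bddAbove
  refine ⟨m, c, fun u hu => exists_isConjProd_of_half hhalf (fun v hv hvn => ?_) u ((hker u).2 hu)⟩
  obtain ⟨A, hA, H⟩ := hc₀ v hv
  have : c₀ v ≤ c := hc ⟨v, hvn.le, rfl⟩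
  exact ⟨A, hA.trans this, H.mono_right this⟩

end Group

theorem mainTheorem3 {G : Type*} [Group G] (S : Finset G)
    (hS : Subgroup.closure (S : Set G) = ⊤) (hcones : AllConesSimplyConnected S hS) :
    Group.IsFinitelyPresented G ∧
    ∀ (X : Type*) [Finite X] (R : Set (FreeGroup X)), R.Finite →
      Nonempty (PresentedGroup R ≃* G) →
      (∃ p : Polynomial ℕ, IsIsoperimetricFunction R fun n => p.eval n) ∧
      IsIsodiametricFunction R fun n => n := by
  classical
  refine ⟨isFinitelyPresented_of_cones hcones, fun X _ R hR ⟨e⟩ => ?_⟩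
  obtain ⟨m, c, hfill⟩ := exists_isConjProd_of_cones hcones e
  -- Finiteness of `R` enters here: it bounds how far a cell extends beyond the end of its
  -- conjugating path.
  obtain ⟨M, hM⟩ := (hR.image FreeGroup.norm).bddAbove
  have hdiag : ∀ (n : ℕ) (w : List (X × Bool)), w.length ≤ n →
      FreeGroup.mk w ∈ Subgroup.normalClosure R → ∃ Δ : VanKampenDiagram R w,
        Δ.area ≤ c * n ^ m ∧ Δ.diameter ≤ (2 * max (2 * m * n + c + M) n : ℕ) := by
    intro n w hw hwR
    obtain ⟨A, hA, H⟩ := hfill _ hwR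
    obtain ⟨Δ, h₁, h₂⟩ := exists_diagram_of_isConjProd (fun r hr => hM ⟨r, hr, rfl⟩) H
    have hn : (FreeGroup.mk w).norm ≤ n := FreeGroup.norm_mk_le.trans hw
    refine ⟨Δ, (h₁.trans hA).trans (by gcongr), h₂.trans ?_⟩
    norm_cast
    gcongr
  refine ⟨⟨Polynomial.C c * Polynomial.X ^ m, 1, fun n => ?_⟩, 4 * m + 2 * c + 2 * M + 2,
    fun n => ?_⟩
  · refine iSup_le fun w => iSup_le fun hw => iSup_le fun hwR => ?_
    obtain ⟨Δ, hΔ, -⟩ := hdiag n w hw hwR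
    refine iInf_le_of_le Δ ?_
    norm_cast
    refine hΔ.trans ?_
    simp only [Polynomial.eval_mul, Polynomial.eval_C, Polynomial.eval_pow, Polynomial.eval_X,
      one_mul]
    omega
  · refine iSup_le fun w => iSup_le fun hw => iSup_le fun hwR => ?_
    obtain ⟨Δ, -, hΔ⟩ := hdiag n w hw hwR
    refine iInf_le_of_le Δ (hΔ.trans ?_)
    norm_cast
    -- The summand `C * n + C` in `≺` alone dominates `2 * (2 * m * n + c + M + n)`.
    refine le_trans ?_ (Nat.add_le_add_right (Nat.le_add_left _ _) _)
    have h : max (2 * m * n + c + M) n ≤ 2 * m * n + c + M + n := by omega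
    nlinarith [Nat.zero_le (c * n), Nat.zero_le (M * n)]
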